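/- Fix a countably infinite set $\mathbb A$ of names and let $\mathrm{Perm}\,\mathbb A$ be the group of its finite permutations. A nominal set is a set $X$ with an action of $\mathrm{Perm}\,\mathbb A$ in which every $x\in X$ has a finite support; $\operatorname{supp}x$ denotes the least finite support, and $x\# y$ ($x$ is fresh for $y$) means $\operatorname{supp}x\cap\operatorname{supp}y=\emptyset$. Let $\mathbf{Nom}$ be the category of nominal sets and equivariant maps; $\mathbb A$ is itself a nominal set. For a set $A$ and a nominal set $Y$ let $Y^{*A}=\{\gamma\colon A\to Y\mid a\neq b\Rightarrow\gamma(a)\#\gamma(b)\}$ with the pointwise action. Let $\mathbb I$ be the category of finite subsets of $\mathbb A$ and injections, and $\psi\colon\mathbb I^{\mathrm{op}}\to\mathbf{Nom}$, $\psi A=\mathbb A^{*A}$. The substitution tensor is the bifunctor on $\mathbf{Nom}$ given by the coend $$X\diamond Y=\int^{A\in\mathbb I}\mathbf{Nom}(\psi A,X)\cdot Y^{*A},$$ where $\cdot$ is the copower. 1. (Explicit description.) The substitution tensor is given by $$X\diamond Y\;\cong\;\{(x,\gamma)\mid x\in X,\ \gamma\in Y^{*\operatorname{supp}x}\}/{\sim},$$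 where $\sim$ is the equivalence relation generated by $(\pi\cdot x,\gamma)\sim(x,\gamma\circ\pi)$ for $\pi\in\mathrm{Perm}\,\mathbb A$, $x\in X$, $\gamma\in Y^{*\operatorname{supp}(\pi\cdot x)}$. Write $x[\gamma]$ for the class of $(x,\gamma)$. Under this isomorphism the coprojection of the coend at $A$ sends $(p,\gamma)$ to $x[\gamma|_{\operatorname{supp}x}]$ with $x=p(A\hookrightarrow\mathbb A)$, and for equivariant $f,g$ the map $f\diamond g$ sends $x[\gamma]$ to $f(x)[g\circ\gamma|_{\operatorname{supp}f(x)}]$. Moreover $$\pi\cdot x[\gamma]=x[\pi\cdot\gamma],\qquad \operatorname{supp}x[\gamma]=\operatorname{supp}\gamma=\bigcup_{a\in\operatorname{supp}x}\operatorname{supp}\gamma(a).$$ 2. (Monoidal structure.) $(\mathbf{Nom},\diamond,\mathbb A)$ is a monoidal category with unit $\psi 1\cong\mathbb A$. Its associator is $(x[\gamma])[\delta]\mapsto x[a\mapsto\gamma(a)[\delta|_{\operatorname{supp}\gamma(a)}]]$, its left unitor $\mathbb A\diamond X\cong X$ is $a[\gamma]\mapsto\gamma(a)$, and its right unitor $X\diamond\mathbb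 A\cong X$ is $x[\gamma]\mapsto\pi\cdot x$ for any $\pi\in\mathrm{Perm}\,\mathbb A$ that agrees with $\gamma$ on $\operatorname{supp}x$. 3. (Right closedness.) For nominal sets $Y,Z$ let $Y\multimap Z$ be the set of equivariant maps $f\colon Y^{*\mathbb A}\to Z$ that are finitely reducible, i.e. factor through the restriction $p_A\colon Y^{*\mathbb A}\to Y^{*A}$ for some finite proper subset $A\subsetneq\mathbb A$; it is a nominal set under $(\pi\cdot f)(\gamma)=f(\gamma\circ\pi)$, and a functor in $Z$ by postcomposition. For every nonempty nominal set $Y$ the functor $(-)\diamond Y$ is left adjoint to $Y\multimap(-)$, $$\mathbf{Nom}(X\diamond Y,Z)\cong\mathbf{Nom}(X,Y\multimap Z),$$ where $f\colon X\diamond Y\to Z$ corresponds to $x\mapsto\bigl(\gamma\mapsto f(x[\gamma|_{\operatorname{supp}x}])\bigr)$, and $g\colon X\to(Y\multimap Z)$ corresponds to $x[\gamma]\mapsto g(x)(\hat\gamma)$ for any $\hat\gamma\in Y^{*\mathbb A}$ with $\hat\gamma|_{\operatorname{supp}x}=\gamma$; such a $\hat\gamma$ always exists. -/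

import Mathlib

open CategoryTheory CategoryTheory.Limits Opposite

universe u

namespace NomSubst

section Basics

variable (𝔸 : Type u)

/-- The group of finite permutations of the set `𝔸` of names. -/
def finPerm : Subgroup (Equiv.Perm 𝔸) where
  carrier := {π | {a | π a ≠ a}.Finite}
  one_mem' := by simp
  mul_mem' := by
    intro π σ hπ hσ
    refine (Set.Finite.union hπ hσ).subset ?_
    intro a ha
    by_contra h
    simp only [Set.mem_union, Set.mem_ofPred_eq, not_or, not_not] at h
    exact ha (by simp [h.1, h.2])
  inv_mem' := by
    intro π hπ
    refine Set.Finite.subset hπ ?_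
    intro a ha h
    exact ha (by rw [Equiv.Perm.inv_eq_iff_eq]; exact h.symm)

abbrev FinPerm : Type u := ↥(finPerm 𝔸)

/-- A nominal set: a set with an action of the finite permutations in which every element
is supported by a finite set of names. -/
structure Nom where
  carrier : Type u
  [act : MulAction (FinPerm 𝔸) carrier]
  nominal : ∀ x : carrier, ∃ S : Finset 𝔸, MulAction.Supports (FinPerm 𝔸) (S : Set 𝔸) x

instance : CoeSort (Nom 𝔸) (Type u) := ⟨Nom.carrier⟩

attribute [instance] Nom.act

/-- Morphisms of nominal sets are the equivariant maps. -/
instance : Category (Nom 𝔸) where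
  Hom X Y := X →[FinPerm 𝔸] Y
  id X := MulActionHom.id (FinPerm 𝔸)
  comp f g := MulActionHom.comp g f

instance : ConcreteCategory (Nom 𝔸) (fun X Y => X →[FinPerm 𝔸] Y) where
  hom f := f
  ofHom f := f

end Basics

variable {𝔸 : Type u}

/-- A bundled equivariant map as a morphism of nominal sets. -/
def Nom.homMk {X Y : Nom 𝔸} (f : X → Y) (hf : ∀ (π : FinPerm 𝔸) (x : X), f (π • x) = π • f x) :
    X ⟶ Y :=
  ({ toFun := f, map_smul' := hf } : X →[FinPerm 𝔸] Y)

@[simp] lemma Nom.homMk_apply {X Y : Nom 𝔸} (f : X → Y)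
    (hf : ∀ (π : FinPerm 𝔸) (x : X), f (π • x) = π • f x) (x : X) : Nom.homMk f hf x = f x := rfl

lemma Nom.hom_smul {X Y : Nom 𝔸} (f : X ⟶ Y) (π : FinPerm 𝔸) (x : X) : f (π • x) = π • f x :=
  MulActionHom.map_smul (show X →[FinPerm 𝔸] Y from f) π x

lemma Nom.hom_ext {X Y : Nom 𝔸} {f g : X ⟶ Y} (h : ∀ x : X, f x = g x) : f = g :=
  ConcreteCategory.hom_ext _ _ h

section Supp

/-- The least finite support of `x`: the intersection of all its finite supports. -/
noncomputable def supp {X : Nom 𝔸} (x : X) : Finset 𝔸 :=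
  Set.Finite.toFinset
    (s := {a | ∀ S : Finset 𝔸, MulAction.Supports (FinPerm 𝔸) (S : Set 𝔸) x → a ∈ S}) (by
      obtain ⟨S, hS⟩ := X.nominal x
      exact S.finite_toSet.subset fun a ha => ha S hS)

lemma mem_supp {X : Nom 𝔸} {x : X} {a : 𝔸} :
    a ∈ supp x ↔
      ∀ S : Finset 𝔸, MulAction.Supports (FinPerm 𝔸) (S : Set 𝔸) x → a ∈ S := by
  simp [supp]

lemma supp_subset {X : Nom 𝔸} {x : X} {S : Finset 𝔸}
    (h : MulAction.Supports (FinPerm 𝔸) (S : Set 𝔸) x) : supp x ⊆ S :=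
  fun _ ha => mem_supp.1 ha S h

/-- The transposition of two names. -/
noncomputable def swp (a b : 𝔸) : FinPerm 𝔸 :=
  letI := Classical.decEq 𝔸
  ⟨Equiv.swap a b, (Set.toFinite {a, b}).subset fun c hc => by
    by_contra h
    simp only [Set.mem_insert_iff, Set.mem_singleton_iff, not_or] at h
    exact hc (Equiv.swap_apply_of_ne_of_ne h.1 h.2)⟩

lemma swp_left (a b : 𝔸) : swp a b • a = b := by
  classical
  change (Equiv.swap a b : Equiv.Perm 𝔸) a = b
  exact Equiv.swap_apply_left a b

lemma swp_of_ne {a b c : 𝔸} (h : c ≠ a) (h' : c ≠ b) : swp a b • c = c := by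
  classical
  change (Equiv.swap a b : Equiv.Perm 𝔸) c = c
  exact Equiv.swap_apply_of_ne_of_ne h h'

lemma exists_move [Infinite 𝔸] (S E D : Finset 𝔸) (hD : Disjoint D S) :
    ∃ τ : FinPerm 𝔸, (∀ s ∈ S, τ • s = s) ∧ ∀ d ∈ D, τ • d ∉ E := by
  classical
  induction D using Finset.induction_on with
  | empty => exact ⟨1, by simp, by simp⟩
  | insert d D hd ih =>
    obtain ⟨τ, h1, h2⟩ := ih (hD.mono_left (Finset.subset_insert d D))
    have hdS : d ∉ S := Finset.disjoint_left.1 hD (Finset.mem_insert_self d D)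
    obtain ⟨c, hc⟩ := Infinite.exists_notMem_finset (E ∪ S ∪ D.image (fun x => τ • x))
    simp only [Finset.mem_union, Finset.mem_image, not_or, not_exists, not_and] at hc
    refine ⟨swp (τ • d) c * τ, ?_, ?_⟩
    · intro s hs
      rw [mul_smul, h1 s hs]
      refine swp_of_ne ?_ ?_
      · intro h
        rw [← h1 s hs] at h
        exact hdS ((smul_left_cancel τ h) ▸ hs)
      · rintro rfl
        exact hc.1.2 hs
    · intro e he
      rw [mul_smul]
      rcases Finset.mem_insert.1 he with rfl | he
      · rw [swp_left]
        exact hc.1.1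
      · rw [swp_of_ne]
        · exact h2 e he
        · intro h
          exact hd (smul_left_cancel τ h ▸ he)
        · exact hc.2 e he

lemma supports_inter [Infinite 𝔸] [DecidableEq 𝔸] {X : Nom 𝔸} {x : X} {S T : Finset 𝔸}
    (hS : MulAction.Supports (FinPerm 𝔸) (S : Set 𝔸) x)
    (hT : MulAction.Supports (FinPerm 𝔸) (T : Set 𝔸) x) :
    MulAction.Supports (FinPerm 𝔸) ((S ∩ T : Finset 𝔸) : Set 𝔸) x := by
  intro π hπ
  have hfin : {a | π.1 a ≠ a}.Finite := π.2
  obtain ⟨τ, h1, h2⟩ := exists_move S hfin.toFinset (T \ S) Finset.sdiff_disjoint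
  have hτ : τ • x = x := hS τ fun a ha => h1 a ha
  have key : (τ⁻¹ * π * τ) • x = x := by
    refine hT _ fun t ht => ?_
    rw [mul_smul, mul_smul, inv_smul_eq_iff]
    by_cases hs : t ∈ S
    · rw [h1 t hs]
      exact hπ (by simp [hs, ht])
    · have := h2 t (Finset.mem_sdiff.2 ⟨ht, hs⟩)
      simp only [Set.Finite.mem_toFinset, Set.mem_ofPred_eq, not_not] at this
      exact this
  rw [mul_smul, mul_smul, inv_smul_eq_iff, hτ] at key
  exact key

/-- `supp x` is indeed a support of `x`. -/
lemma supports_supp [Infinite 𝔸] {X : Nom 𝔸} (x : X) :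
    MulAction.Supports (FinPerm 𝔸) (supp x : Set 𝔸) x := by
  classical
  have hex : ∃ n : ℕ, ∃ S : Finset 𝔸,
      MulAction.Supports (FinPerm 𝔸) (S : Set 𝔸) x ∧ S.card = n := by
    obtain ⟨S, hS⟩ := X.nominal x
    exact ⟨_, S, hS, rfl⟩
  obtain ⟨S, hS, hc⟩ := Nat.find_spec hex
  suffices h : S ⊆ supp x from hS.mono (by exact_mod_cast h)
  intro a ha
  refine mem_supp.2 fun T hT => ?_
  by_contra haT
  have hlt : (S ∩ T).card < S.card :=
    Finset.card_lt_card (Finset.ssubset_iff_subset_ne.2 ⟨Finset.inter_subset_left,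
      fun h => haT (Finset.mem_inter.1 (h.symm ▸ ha)).2⟩)
  rw [hc] at hlt
  exact Nat.find_min hex hlt ⟨_, supports_inter hS hT, rfl⟩

lemma supports_smul [DecidableEq 𝔸] {X : Nom 𝔸} {x : X} {S : Finset 𝔸} (π : FinPerm 𝔸)
    (hS : MulAction.Supports (FinPerm 𝔸) (S : Set 𝔸) x) :
    MulAction.Supports (FinPerm 𝔸) ((S.image (fun a => π • a) : Finset 𝔸) : Set 𝔸) (π • x) := by
  intro σ hσ
  have : (π⁻¹ * σ * π) • x = x := by
    refine hS _ fun a ha => ?_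
    rw [mul_smul, mul_smul, inv_smul_eq_iff]
    exact hσ (Finset.mem_coe.2 (Finset.mem_image_of_mem _ (Finset.mem_coe.1 ha)))
  rwa [mul_smul, mul_smul, inv_smul_eq_iff] at this

lemma smul_mem_supp {X : Nom 𝔸} (π : FinPerm 𝔸) {x : X} {a : 𝔸} (h : a ∈ supp x) :
    π • a ∈ supp (π • x) := by
  classical
  refine mem_supp.2 fun S hS => ?_
  have h1 := supports_smul π⁻¹ hS
  rw [inv_smul_smul] at h1
  obtain ⟨b, hb, hba⟩ := Finset.mem_image.1 (mem_supp.1 h _ h1)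
  rw [← hba, smul_inv_smul]
  exact hb

lemma supp_hom_subset {X Y : Nom 𝔸} [Infinite 𝔸] (f : X ⟶ Y) (x : X) : supp (f x) ⊆ supp x :=
  supp_subset fun π hπ => by rw [← Nom.hom_smul, supports_supp x π hπ]

/-- `x # y`. -/
def Fresh {X Y : Nom 𝔸} (x : X) (y : Y) : Prop := Disjoint (supp x) (supp y)

lemma Fresh.smul {X Y : Nom 𝔸} {x : X} {y : Y} (h : Fresh x y) (π : FinPerm 𝔸) :
    Fresh (π • x) (π • y) := by
  refine Finset.disjoint_left.2 fun a ha hb => ?_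
  have h1 := smul_mem_supp π⁻¹ ha
  have h2 := smul_mem_supp π⁻¹ hb
  rw [inv_smul_smul] at h1 h2
  exact Finset.disjoint_left.1 h h1 h2

end Supp

section FreshPower

/-- The fresh power `Y^{*ι}`: maps `ι → Y` whose values at distinct indices are fresh for
each other. -/
@[ext]
structure FreshPow (ι : Type u) (Y : Nom 𝔸) where
  toFun : ι → Y
  fresh : ∀ a b : ι, a ≠ b → Fresh (toFun a) (toFun b)

instance {ι : Type u} {Y : Nom 𝔸} : CoeFun (FreshPow ι Y) (fun _ => ι → Y) := ⟨FreshPow.toFun⟩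

/-- The pointwise action on `Y^{*ι}`. -/
instance {ι : Type u} {Y : Nom 𝔸} : MulAction (FinPerm 𝔸) (FreshPow ι Y) where
  smul π γ := ⟨fun a => π • γ a, fun a b h => (γ.fresh a b h).smul π⟩
  one_smul γ := FreshPow.ext (funext fun a => one_smul _ (γ a))
  mul_smul π σ γ := FreshPow.ext (funext fun a => mul_smul π σ (γ a))

@[simp] lemma FreshPow.smul_apply {ι : Type u} {Y : Nom 𝔸} (π : FinPerm 𝔸) (γ : FreshPow ι Y)
    (a : ι) : (π • γ) a = π • γ a := rfl

/-- Reindexing `γ ∘ j` along an injection. -/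
def FreshPow.comp {ι κ : Type u} {Y : Nom 𝔸} (γ : FreshPow κ Y) (j : ι ↪ κ) : FreshPow ι Y :=
  ⟨fun a => γ (j a), fun _ _ h => γ.fresh _ _ (fun h' => h (j.injective h'))⟩

/-- The restriction of `γ ∈ Y^{*B}` to `A ⊆ B`. -/
def FreshPow.restrict {A B : Finset 𝔸} {Y : Nom 𝔸} (γ : FreshPow B Y) (h : A ⊆ B) :
    FreshPow A Y :=
  γ.comp ⟨fun a => ⟨a.1, h a.2⟩, fun _ _ h' => Subtype.ext (congrArg (fun z => z.1) h')⟩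

/-- The projection `p_A : Y^{*𝔸} → Y^{*A}`. -/
def FreshPow.proj {Y : Nom 𝔸} (γ : FreshPow 𝔸 Y) (A : Finset 𝔸) : FreshPow A Y :=
  γ.comp (Function.Embedding.subtype _)

/-- The map `g ∘ γ` for an equivariant map `g`. -/
def FreshPow.map [Infinite 𝔸] {ι : Type u} {Y Y' : Nom 𝔸} (g : Y ⟶ Y') (γ : FreshPow ι Y) :
    FreshPow ι Y' :=
  ⟨fun a => g (γ a), fun a b h =>
    (γ.fresh a b h).mono (supp_hom_subset g _) (supp_hom_subset g _)⟩

/-- For a finite set `ι`, the fresh power `Y^{*ι}` is a nominal set. -/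
def freshPow [Infinite 𝔸] (ι : Type u) [Finite ι] (Y : Nom 𝔸) : Nom 𝔸 where
  carrier := FreshPow ι Y
  nominal γ := by
    classical
    have := Fintype.ofFinite ι
    refine ⟨Finset.univ.biUnion fun a => supp (γ a), fun π hπ => ?_⟩
    refine FreshPow.ext (funext fun a => supports_supp (γ a) π fun b hb => hπ ?_)
    simp only [Finset.coe_biUnion, Set.mem_iUnion]
    exact ⟨a, by simp, hb⟩

variable (𝔸) in
/-- The nominal set of atoms. -/
def atoms : Nom 𝔸 where
  carrier := 𝔸
  nominal a := ⟨{a}, fun π hπ => hπ (by simp)⟩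

end FreshPower

section Tensor

/-- `π` as an injection `supp x ↪ supp (π • x)`. -/
def suppMap {X : Nom 𝔸} (π : FinPerm 𝔸) (x : X) : supp x ↪ supp (π • x) :=
  ⟨fun a => ⟨π • a.1, smul_mem_supp π a.2⟩, fun _ _ h =>
    Subtype.ext (smul_left_cancel π (congrArg (fun z => z.1) h))⟩

/-- Pairs `(x, γ)` with `x ∈ X` and `γ ∈ Y^{*supp x}`. -/
abbrev PreTensor (X Y : Nom 𝔸) : Type u := Σ x : X, FreshPow (supp x) Y

/-- The generating relation `(π • x, γ) ∼ (x, γ ∘ π)`. -/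
inductive TensorRel (X Y : Nom 𝔸) : PreTensor X Y → PreTensor X Y → Prop
  | mk (π : FinPerm 𝔸) (x : X) (γ : FreshPow (supp (π • x)) Y) :
      TensorRel X Y ⟨π • x, γ⟩ ⟨x, γ.comp (suppMap π x)⟩

/-- The quotient by the equivalence relation generated by `TensorRel`. -/
def TensorCarrier (X Y : Nom 𝔸) : Type u := Quot (TensorRel X Y)

/-- The equivalence class `x[γ]`. -/
def TensorCarrier.mk {X Y : Nom 𝔸} (x : X) (γ : FreshPow (supp x) Y) : TensorCarrier X Y :=
  Quot.mk _ ⟨x, γ⟩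

/-- The action `π • x[γ] = x[π • γ]`. -/
instance (X Y : Nom 𝔸) : MulAction (FinPerm 𝔸) (TensorCarrier X Y) where
  smul π := Quot.map (fun p => ⟨p.1, π • p.2⟩) (by
    rintro _ _ ⟨σ, x, γ⟩
    exact TensorRel.mk σ x (π • γ))
  one_smul := by
    rintro ⟨x, γ⟩
    exact congrArg (TensorCarrier.mk x) (one_smul _ γ)
  mul_smul := by
    rintro π σ ⟨x, γ⟩
    exact congrArg (TensorCarrier.mk x) (mul_smul π σ γ)

lemma TensorCarrier.smul_mk {X Y : Nom 𝔸} (π : FinPerm 𝔸) (x : X) (γ : FreshPow (supp x) Y) :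
    π • TensorCarrier.mk x γ = TensorCarrier.mk x (π • γ) := rfl

variable [Infinite 𝔸]

/-- The substitution tensor `X ⋄ Y`. -/
def tensor (X Y : Nom 𝔸) : Nom 𝔸 where
  carrier := TensorCarrier X Y
  nominal := by
    rintro ⟨x, γ⟩
    obtain ⟨S, hS⟩ := (freshPow (supp x) Y).nominal γ
    exact ⟨S, fun π hπ => congrArg (TensorCarrier.mk x) (hS π hπ)⟩

/-- The class `x[γ]` as an element of the nominal set `X ⋄ Y`. -/
def sub {X Y : Nom 𝔸} (x : X) (γ : FreshPow (supp x) Y) : tensor X Y := TensorCarrier.mk x γ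

lemma sub_ind {X Y : Nom 𝔸} {P : tensor X Y → Prop}
    (h : ∀ (x : X) (γ : FreshPow (supp x) Y), P (sub x γ)) (t : tensor X Y) : P t :=
  Quot.ind (fun p => h p.1 p.2) t

lemma sub_smul {X Y : Nom 𝔸} (π : FinPerm 𝔸) (x : X) (γ : FreshPow (supp (π • x)) Y) :
    sub (π • x) γ = sub x (γ.comp (suppMap π x)) :=
  Quot.sound (TensorRel.mk π x γ)

lemma sub_congr {X Y : Nom 𝔸} {x x' : X} (h : x = x') {γ : FreshPow (supp x) Y}
    {γ' : FreshPow (supp x') Y} (hγ : ∀ a (ha : a ∈ supp x) (ha' : a ∈ supp x'),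
      γ ⟨a, ha⟩ = γ' ⟨a, ha'⟩) : sub x γ = sub x' γ' := by
  subst h
  exact congrArg (sub x) (FreshPow.ext (funext fun a => hγ a.1 a.2 a.2))

/-- The functorial action `x[γ] ↦ f(x)[g ∘ γ|_{supp f(x)}]` of the substitution tensor. -/
noncomputable def tensorMap {X X' Y Y' : Nom 𝔸} (f : X ⟶ X') (g : Y ⟶ Y') : tensor X Y ⟶ tensor X' Y' :=
  Nom.homMk
    (Quot.lift (fun p => sub (f p.1) ((p.2.restrict (supp_hom_subset f p.1)).map g)) (by
      rintro _ _ ⟨π, x, γ⟩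
      have h := Nom.hom_smul f π x
      refine Eq.trans ?_ (sub_smul (Y := Y') π (f x)
        ⟨fun a => g (γ ⟨a.1, supp_hom_subset f _ (by rw [h]; exact a.2)⟩), fun _ _ hab =>
          (γ.fresh _ _ (fun h' => hab (Subtype.ext (congrArg (fun z => z.1) h')))).mono
            (supp_hom_subset g _) (supp_hom_subset g _)⟩)
      exact sub_congr h fun a ha ha' => rfl))
    (by
      rintro π ⟨x, γ⟩
      exact congrArg (sub (f x)) (FreshPow.ext (funext fun a => Nom.hom_smul g π _)))

/-- The functor `(-) ⋄ Y`. -/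
noncomputable def tensorRightFunctor (Y : Nom 𝔸) : Nom 𝔸 ⥤ Nom 𝔸 where
  obj X := tensor X Y
  map f := tensorMap f (𝟙 Y)
  map_id _ := Nom.hom_ext (sub_ind fun _ _ => rfl)
  map_comp _ _ := Nom.hom_ext (sub_ind fun _ _ => rfl)

/-- The data of a monoidal category on nominal sets with tensor `⋄` and unit `𝔸`, for given
associators and unitors. -/
@[reducible] noncomputable def substStruct
    (α : ∀ X Y Z : Nom 𝔸, tensor (tensor X Y) Z ≅ tensor X (tensor Y Z))
    (l : ∀ X : Nom 𝔸, tensor (atoms 𝔸) X ≅ X)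
    (r : ∀ X : Nom 𝔸, tensor X (atoms 𝔸) ≅ X) : MonoidalCategoryStruct (Nom 𝔸) where
  tensorObj X Y := tensor X Y
  whiskerLeft X _ _ g := tensorMap (𝟙 X) g
  whiskerRight f Y := (tensorRightFunctor Y).map f
  tensorHom f g := tensorMap f g
  tensorUnit := atoms 𝔸
  associator := α
  leftUnitor := l
  rightUnitor := r

end Tensor

section Coend

/-- Objects of the category `𝕀`: finite subsets of `𝔸`. -/
structure Ctx (𝔸 : Type u) where
  set : Finset 𝔸

/-- Morphisms of `𝕀`: injections. -/
instance : Category (Ctx 𝔸) where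
  Hom A B := A.set ↪ B.set
  id A := Function.Embedding.refl _
  comp f g := f.trans g

variable [Infinite 𝔸]

/-- The functor `𝕀ᵒᵖ → Nom`, `A ↦ A ◁ Y = Y^{*A}`. -/
def actFunctor (Y : Nom 𝔸) : (Ctx 𝔸)ᵒᵖ ⥤ Nom 𝔸 where
  obj A := freshPow A.unop.set Y
  map {A B} j := Nom.homMk
    (X := freshPow A.unop.set Y) (Y := freshPow B.unop.set Y)
    (fun γ => FreshPow.comp γ (show B.unop.set ↪ A.unop.set from j.unop)) (fun _ _ => rfl)
  map_id _ := rfl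
  map_comp _ _ := rfl

variable (𝔸) in
/-- The functor `ψ : 𝕀ᵒᵖ → Nom`, `ψ A = 𝔸^{*A}`. -/
def psi : (Ctx 𝔸)ᵒᵖ ⥤ Nom 𝔸 := actFunctor (atoms 𝔸)

/-- The copower `S · N`, the coproduct of `S` copies of `N`. -/
def copower (S : Type u) (N : Nom 𝔸) : Nom 𝔸 where
  carrier := S × N
  act :=
    { smul := fun π p => (p.1, π • p.2)
      one_smul := fun p => Prod.ext rfl (one_smul _ p.2)
      mul_smul := fun π σ p => Prod.ext rfl (mul_smul π σ p.2) }
  nominal p := by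
    obtain ⟨S, hS⟩ := N.nominal p.2
    exact ⟨S, fun π hπ => Prod.ext rfl (hS π hπ)⟩

/-- Functoriality of copowers. -/
def copowerMap {S S' : Type u} {N N' : Nom 𝔸} (s : S → S') (f : N ⟶ N') :
    copower S N ⟶ copower S' N' :=
  Nom.homMk (X := copower S N) (Y := copower S' N') (fun p => (s p.1, f p.2))
    (fun π p => Prod.ext rfl (Nom.hom_smul f π p.2))

/-- The bifunctor `(A, B) ↦ Nom(ψ B, X) · Y^{*A}`. -/
def coendDiagram (X Y : Nom 𝔸) : (Ctx 𝔸)ᵒᵖ ⥤ Ctx 𝔸 ⥤ Nom 𝔸 where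
  obj A :=
    { obj := fun B => copower ((psi 𝔸).obj (op B) ⟶ X) ((actFunctor Y).obj A)
      map := fun j => copowerMap (fun p => (psi 𝔸).map j.op ≫ p) (𝟙 _)
      map_id := fun _ => rfl
      map_comp := fun _ _ => rfl }
  map i :=
    { app := fun _ => copowerMap id ((actFunctor Y).map i)
      naturality := fun _ _ _ => rfl }
  map_id _ := rfl
  map_comp _ _ := rfl

/-- The inclusion `A ⊆ 𝔸` as an element of `ψ A`. -/
def inclAtoms (A : Ctx 𝔸) : (psi 𝔸).obj (op A) :=
  (⟨fun a => a.1, fun a b h => Finset.disjoint_of_subset_left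
      (supp_subset (S := {a.1}) fun π hπ => hπ (by simp))
      (Finset.disjoint_of_subset_right
        (supp_subset (S := {b.1}) fun π hπ => hπ (by simp))
        (Finset.disjoint_singleton.2 fun h' => h (Subtype.ext h')))⟩ : FreshPow A.set (atoms 𝔸))

/-- The coprojection `κ_A : Nom(ψ A, X) · Y^{*A} → c` of a cowedge, at an element `(p, γ)`. -/
def cowedgeProj {X Y : Nom 𝔸} (c : Cowedge (coendDiagram X Y)) (A : Ctx 𝔸)
    (p : (psi 𝔸).obj (op A) ⟶ X) (γ : FreshPow A.set Y) : c.pt :=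
  (show copower ((psi 𝔸).obj (op A) ⟶ X) (freshPow A.set Y) ⟶ c.pt from c.π A) (p, γ)

end Coend

section Hom

/-- A map `f : Y^{*𝔸} → Z` is finitely reducible if it factors through the projection
`p_A : Y^{*𝔸} → Y^{*A}` for some finite proper subset `A` of `𝔸`. -/
def FinitelyReducible {Y : Nom 𝔸} {Z : Type u} (f : FreshPow 𝔸 Y → Z) : Prop :=
  ∃ A : Finset 𝔸, (A : Set 𝔸) ⊂ Set.univ ∧
    ∃ g : FreshPow A Y → Z, ∀ γ : FreshPow 𝔸 Y, f γ = g (γ.proj A)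

/-- The finitely reducible equivariant maps `Y^{*𝔸} → Z`. -/
structure FinRedMap (Y Z : Nom 𝔸) where
  hom : FreshPow 𝔸 Y →[FinPerm 𝔸] Z
  reducible : FinitelyReducible (hom : FreshPow 𝔸 Y → Z)

instance {Y Z : Nom 𝔸} : CoeFun (FinRedMap Y Z) (fun _ => FreshPow 𝔸 Y → Z) :=
  ⟨fun f => f.hom⟩

lemma FinRedMap.ext {Y Z : Nom 𝔸} {f g : FinRedMap Y Z} (h : ∀ γ, f γ = g γ) : f = g := by
  obtain ⟨f, hf⟩ := f
  obtain ⟨g, hg⟩ := g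
  obtain rfl : f = g := MulActionHom.ext h
  rfl

/-- The reindexing `γ ∘ π`. -/
def FreshPow.precomp {Y : Nom 𝔸} (γ : FreshPow 𝔸 Y) (π : FinPerm 𝔸) : FreshPow 𝔸 Y :=
  γ.comp π.1.toEmbedding

lemma FinitelyReducible.precomp {Y : Nom 𝔸} {Z : Type u} {f : FreshPow 𝔸 Y → Z}
    (hf : FinitelyReducible f) (π : FinPerm 𝔸) :
    FinitelyReducible fun γ => f (γ.precomp π) := by
  classical
  obtain ⟨A, hA, g, hg⟩ := hf
  refine ⟨A.image (fun a => π • a), ?_, fun γ => g (γ.comp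
    ⟨fun a => ⟨π • a.1, Finset.mem_image_of_mem _ a.2⟩, fun a b h =>
      Subtype.ext (smul_left_cancel π (congrArg (fun z => z.1) h))⟩), fun γ => ?_⟩
  · rw [Set.ssubset_univ_iff] at hA ⊢
    intro h
    apply hA
    ext a
    have : π • a ∈ ((A.image (fun a => π • a) : Finset 𝔸) : Set 𝔸) := by rw [h]; trivial
    simpa using this
  · exact hg _

/-- The action `(π • f)(γ) = f(γ ∘ π)`. -/
instance (Y Z : Nom 𝔸) : MulAction (FinPerm 𝔸) (FinRedMap Y Z) where
  smul π f :=
    { hom :=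
        { toFun := fun γ => f (γ.precomp π)
          map_smul' := fun σ γ => f.hom.map_smul σ (γ.precomp π) }
      reducible := f.reducible.precomp π }
  one_smul _ := FinRedMap.ext fun _ => rfl
  mul_smul _ _ _ := FinRedMap.ext fun _ => rfl

lemma FinRedMap.smul_apply {Y Z : Nom 𝔸} (π : FinPerm 𝔸) (f : FinRedMap Y Z)
    (γ : FreshPow 𝔸 Y) : (π • f) γ = f (γ.precomp π) := rfl

/-- The internal hom `Y ⊸ Z`. -/
def homObj (Y Z : Nom 𝔸) : Nom 𝔸 where
  carrier := FinRedMap Y Z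
  nominal f := by
    obtain ⟨A, -, g, hg⟩ := f.reducible
    refine ⟨A, fun π hπ => FinRedMap.ext fun γ => ?_⟩
    refine (hg _).trans (Eq.trans (congrArg g ?_) (hg γ).symm)
    exact FreshPow.ext (funext fun a => congrArg γ.toFun (hπ a.2))

/-- The functor `Y ⊸ (-)`, acting by postcomposition. -/
def homFunctor (Y : Nom 𝔸) : Nom 𝔸 ⥤ Nom 𝔸 where
  obj Z := homObj Y Z
  map {Z Z'} h := Nom.homMk (X := homObj Y Z) (Y := homObj Y Z')
    (fun f => (
      { hom :=
          { toFun := fun γ => h (FinRedMap.hom f γ)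
            map_smul' := fun π γ =>
              (congrArg h ((FinRedMap.hom f).map_smul π γ)).trans (Nom.hom_smul h π _) }
        reducible := by
          obtain ⟨A, hA, g, hg⟩ := FinRedMap.reducible f
          exact ⟨A, hA, fun γ => h (g γ), fun γ => congrArg h (hg γ)⟩ } : FinRedMap Y Z'))
    (fun _ _ => rfl)
  map_id _ := rfl
  map_comp _ _ := rfl

/-- The value `f(γ)` of an element of `Y ⊸ Z`. -/
def homEval {Y Z : Nom 𝔸} (f : homObj Y Z) (γ : FreshPow 𝔸 Y) : Z := FinRedMap.hom f γ

end Hom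

end NomSubst

open NomSubst

/-! Two facts drive everything: an injection of a finite set of names into the names extends to a
finite permutation (`exists_finPerm_extend`), and `π • x` depends only on `π` on `supp x`
(`smul_congr`). The first shows that equality in the quotient is witnessed by one permutation, with
no chain of generating steps (`exists_of_sub_eq`, conversely `sub_eq_sub`).

For the coend, every element of `ψ A` is a permuted inclusion, so an equivariant `p : ψ A → X` is
determined by `x`, its value at the inclusion, and factors through restriction to `supp x`
(`map_comp_orbitMap`). Hence any cowedge identifies `(p, γ)` with the pair of `orbitMap x` and `γ`
restricted to `supp x`, and these normal forms are glued exactly by the generating relation.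

For associativity, permutations witnessing equality of the values `γ(a)[δ]` separately for each `a`
glue to a single one, because the supports of the `γ(a)` are disjoint (`exists_finPerm_glue`,
`sub_assocPow_eq_iff`). Surjectivity needs the representatives of the values to be moved apart first
(`exists_fresh_smul`). The coherence laws are then checked on representatives.

For closedness, the point is that `f(γ)` depends only on `γ` restricted to `supp f`
(`homEval_congr`), although finite reducibility provides only some finite set. Since finite fresh
families extend to all names when `Y` is nonempty, evaluating at an arbitrary extension inverts
transposition. -/

namespace NomSubst

variable {𝔸 : Type u}

/-! ### Extending finite injections, and supports of names -/

section Permutations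

/-- A map that is injective on a finite set of names agrees there with a finite permutation. -/
lemma exists_finPerm_eqOn (S : Finset 𝔸) (f : 𝔸 → 𝔸) (hf : Set.InjOn f S) :
    ∃ π : FinPerm 𝔸, ∀ a ∈ S, π • a = f a := by
  classical
  induction S using Finset.induction_on with
  | empty => exact ⟨1, by simp⟩
  | insert d S hd ih =>
    obtain ⟨π, hπ⟩ := ih (hf.mono (by simp))
    -- The transposition corrects the value at `d`; it leaves the value at `a ∈ S` alone, since this
    -- differs from `π • d` and, by injectivity of `f`, from `f d`.
    refine ⟨swp (π • d) (f d) * π, fun a ha => ?_⟩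
    rw [mul_smul]
    rcases Finset.mem_insert.1 ha with rfl | ha'
    · exact swp_left _ _
    · have hne : a ≠ d := fun h => hd (h ▸ ha')
      rw [swp_of_ne (fun h => hne (smul_left_cancel π h)), hπ a ha']
      rw [hπ a ha']
      exact fun h => hne (hf ha (by simp) h)

/-- An injection of a finite set of names into the names extends to a finite permutation. -/
lemma exists_finPerm_extend {S : Finset 𝔸} (f : S → 𝔸) (hf : Function.Injective f) :
    ∃ π : FinPerm 𝔸, ∀ a : S, π • a.1 = f a := by
  classical
  obtain ⟨π, hπ⟩ := exists_finPerm_eqOn S (fun a => if h : a ∈ S then f ⟨a, h⟩ else a) (by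
    intro a ha b hb hab
    rw [Finset.mem_coe] at ha hb
    simp only [ha, hb, dif_pos] at hab
    exact congrArg Subtype.val (hf hab))
  exact ⟨π, fun a => by rw [hπ a.1 a.2, dif_pos a.2]⟩

lemma smul_mem_supp_iff {X : Nom 𝔸} (π : FinPerm 𝔸) {x : X} {a : 𝔸} :
    π • a ∈ supp (π • x) ↔ a ∈ supp x := by
  refine ⟨fun h => ?_, smul_mem_supp π⟩
  have := smul_mem_supp π⁻¹ h
  rwa [inv_smul_smul, inv_smul_smul] at this

lemma mem_supp_smul {X : Nom 𝔸} (π : FinPerm 𝔸) {x : X} {a : 𝔸} :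
    a ∈ supp (π • x) ↔ π⁻¹ • a ∈ supp x := by
  rw [← smul_mem_supp_iff π (a := π⁻¹ • a), smul_inv_smul]

lemma smul_congr [Infinite 𝔸] {X : Nom 𝔸} {x : X} {π σ : FinPerm 𝔸}
    (h : ∀ a ∈ supp x, π • a = σ • a) : π • x = σ • x := by
  have := supports_supp x (σ⁻¹ * π) fun a ha => by
    rw [mul_smul, h a ha, inv_smul_smul]
  rwa [mul_smul, inv_smul_eq_iff] at this

/-- A finite permutation carrying a given finite set away from another one. -/
lemma exists_smul_disjoint [Infinite 𝔸] (E D : Finset 𝔸) :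
    ∃ τ : FinPerm 𝔸, ∀ d ∈ D, τ • d ∉ E := by
  obtain ⟨τ, -, h⟩ := exists_move ∅ E D (Finset.disjoint_empty_right D)
  exact ⟨τ, h⟩

/-- A finite set of names attached equivariantly to `x` is contained in the support of `x`. -/
lemma subset_supp_of_equivariant [Infinite 𝔸] {X : Nom 𝔸} (F : X → Finset 𝔸)
    (hF : ∀ (π : FinPerm 𝔸) (x : X) (a : 𝔸), a ∈ F x → π • a ∈ F (π • x)) (x : X) :
    F x ⊆ supp x := by
  classical
  intro a ha
  by_contra hs
  obtain ⟨c, hc⟩ := Infinite.exists_notMem_finset (F x ∪ supp x)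
  simp only [Finset.mem_union, not_or] at hc
  -- With both `a` and `c` outside the support, the swap fixes `x`, so equivariance would put `c`
  -- into `F x`.
  have h1 : swp a c • x = x := supports_supp x _ fun b hb =>
    swp_of_ne (fun h => hs (h ▸ hb)) (fun h => hc.2 (h ▸ hb))
  have h2 := hF (swp a c) x a ha
  rw [h1, swp_left] at h2
  exact hc.1 h2

lemma supp_atom [Infinite 𝔸] (a : 𝔸) : supp (X := atoms 𝔸) a = {a} := by
  refine Finset.Subset.antisymm (supp_subset fun π hπ => hπ (Finset.mem_singleton_self a)) ?_
  refine subset_supp_of_equivariant (X := atoms 𝔸) (fun a : 𝔸 => ({a} : Finset 𝔸)) ?_ a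
  intro π (x : 𝔸) a ha
  exact Finset.mem_singleton.2 (congrArg (fun b : 𝔸 => π • b) (Finset.mem_singleton.1 ha))

lemma mem_supp_atom [Infinite 𝔸] (a : 𝔸) : a ∈ supp (X := atoms 𝔸) a :=
  (supp_atom a).symm ▸ Finset.mem_singleton_self a

lemma freshPow_atoms_injective [Infinite 𝔸] {ι : Type u} (γ : FreshPow ι (atoms 𝔸)) :
    Function.Injective γ := by
  intro a b h
  by_contra hab
  have h1 := γ.fresh a b hab
  rw [← h] at h1
  exact Finset.disjoint_left.1 h1 (mem_supp_atom _) (mem_supp_atom _)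

end Permutations

/-! ### Isomorphisms of nominal sets -/

section Isomorphisms

/-- A bijective equivariant map is an isomorphism of nominal sets. -/
noncomputable def Nom.isoOfBijective {X Y : Nom 𝔸} (f : X ⟶ Y) (hf : Function.Bijective f) :
    X ≅ Y where
  hom := f
  inv := Nom.homMk (Equiv.ofBijective f hf).symm fun π y => by
    apply hf.1
    rw [Nom.hom_smul]
    exact ((Equiv.ofBijective f hf).apply_symm_apply _).trans
      (congrArg (fun z => π • z) ((Equiv.ofBijective f hf).apply_symm_apply y).symm)
  hom_inv_id := Nom.hom_ext fun x => (Equiv.ofBijective f hf).symm_apply_apply x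
  inv_hom_id := Nom.hom_ext fun y => (Equiv.ofBijective f hf).apply_symm_apply y

end Isomorphisms

/-! ### Equality and supports in the tensor -/

section Tensor

variable [Infinite 𝔸] {X Y Z : Nom 𝔸}

lemma sub_eq_sub {x x' : X} {γ : FreshPow (supp x) Y} {γ' : FreshPow (supp x') Y}
    (π : FinPerm 𝔸) (h : π • x = x')
    (hγ : ∀ a (ha : a ∈ supp x) (ha' : π • a ∈ supp x'), γ ⟨a, ha⟩ = γ' ⟨π • a, ha'⟩) :
    sub x γ = sub x' γ' := by
  subst h
  rw [sub_smul]
  exact sub_congr rfl fun a ha _ => hγ a ha _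

/-- Each generating step supplies such a permutation, and identities, inverses and composites of
such permutations are again of this kind, so generating an equivalence adds nothing. -/
lemma exists_of_sub_eq {x x' : X} {γ : FreshPow (supp x) Y} {γ' : FreshPow (supp x') Y}
    (h : sub x γ = sub x' γ') :
    ∃ π : FinPerm 𝔸, π • x = x' ∧
      ∀ a (ha : a ∈ supp x) (ha' : π • a ∈ supp x'), γ ⟨a, ha⟩ = γ' ⟨π • a, ha'⟩ := by
  have key : ∀ p q : PreTensor X Y, Relation.EqvGen (TensorRel X Y) p q →
      ∃ π : FinPerm 𝔸, π • p.1 = q.1 ∧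
        ∀ a (ha : a ∈ supp p.1) (ha' : π • a ∈ supp q.1),
          p.2 ⟨a, ha⟩ = q.2 ⟨π • a, ha'⟩ := by
    intro p q hpq
    induction hpq with
    | rel p q h =>
      obtain ⟨π, x, γ⟩ := h
      refine ⟨π⁻¹, inv_smul_smul π x, fun a ha ha' => congrArg γ.toFun (Subtype.ext ?_)⟩
      exact (smul_inv_smul π a).symm
    | refl p => exact ⟨1, one_smul _ _, fun a ha ha' => by simp⟩
    | symm p q _ ih =>
      obtain ⟨π, h1, h2⟩ := ih
      refine ⟨π⁻¹, by rw [← h1, inv_smul_smul], fun a ha ha' => ?_⟩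
      refine Eq.trans ?_ (h2 (π⁻¹ • a) ha' (by rwa [smul_inv_smul])).symm
      exact congrArg q.2.toFun (Subtype.ext (smul_inv_smul π a).symm)
    | trans p q r _ _ ih1 ih2 =>
      obtain ⟨π, h1, h2⟩ := ih1
      obtain ⟨σ, h3, h4⟩ := ih2
      refine ⟨σ * π, by rw [mul_smul, h1, h3], fun a ha ha' => ?_⟩
      have hm : π • a ∈ supp q.1 := h1 ▸ smul_mem_supp π ha
      exact (h2 a ha hm).trans (h4 _ hm (h3 ▸ smul_mem_supp σ hm))
  exact key _ _ (Quot.eqvGen_exact h)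

/-- Equivariant maps out of the substitution tensor. -/
def tensorLift (f : ∀ x : X, FreshPow (supp x) Y → Z)
    (hf : ∀ (π : FinPerm 𝔸) (x : X) (γ : FreshPow (supp (π • x)) Y),
      f (π • x) γ = f x (γ.comp (suppMap π x)))
    (hs : ∀ (π : FinPerm 𝔸) (x : X) (γ : FreshPow (supp x) Y), f x (π • γ) = π • f x γ) :
    tensor X Y ⟶ Z :=
  Nom.homMk (Quot.lift (fun p => f p.1 p.2) (by rintro _ _ ⟨π, x, γ⟩; exact hf π x γ))
    (fun π => sub_ind fun x γ => hs π x γ)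

lemma smul_sub (π : FinPerm 𝔸) (x : X) (γ : FreshPow (supp x) Y) :
    π • sub x γ = sub x (π • γ) := rfl

lemma mem_supp_freshPow {ι : Type u} [Finite ι] (γ : freshPow ι Y) (b : 𝔸) :
    b ∈ supp γ ↔ ∃ a : ι, b ∈ supp ((show FreshPow ι Y from γ) a) := by
  classical
  have := Fintype.ofFinite ι
  constructor
  · intro h
    have := supp_subset (x := γ) (S := Finset.univ.biUnion fun a =>
      supp ((show FreshPow ι Y from γ) a)) (fun π hπ =>
        FreshPow.ext (funext fun a => supports_supp _ π fun b hb => hπ (by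
          simp only [Finset.coe_biUnion, Set.mem_iUnion]
          exact ⟨a, by simp, hb⟩))) h
    simpa using this
  · rintro ⟨a, ha⟩
    exact supp_hom_subset (X := freshPow ι Y)
      (Nom.homMk (fun γ : FreshPow ι Y => γ a) fun _ _ => rfl) γ ha

open Classical in
/-- The union of the supports of the values of `γ`, as a function of `x[γ]`. -/
noncomputable def valueSupp (t : tensor X Y) : Finset 𝔸 :=
  Quot.lift (fun p : PreTensor X Y => Finset.univ.biUnion fun a => supp (p.2 a)) (by
    rintro _ _ ⟨π, x, γ⟩
    ext b
    simp only [Finset.mem_biUnion, Finset.mem_univ, true_and]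
    constructor
    · rintro ⟨a, ha⟩
      refine ⟨⟨π⁻¹ • a.1, (mem_supp_smul π).1 a.2⟩, ?_⟩
      have : suppMap π x ⟨π⁻¹ • a.1, (mem_supp_smul π).1 a.2⟩ = a :=
        Subtype.ext (smul_inv_smul π a.1)
      change b ∈ supp (γ (suppMap π x _))
      rwa [this]
    · rintro ⟨a, ha⟩
      exact ⟨_, ha⟩) t

lemma mem_valueSupp (x : X) (γ : FreshPow (supp x) Y) (b : 𝔸) :
    b ∈ valueSupp (sub x γ) ↔ ∃ a : supp x, b ∈ supp (γ a) := by
  classical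
  change b ∈ Finset.biUnion _ _ ↔ _
  simp

/-- Whatever fixes `γ` fixes its class, which bounds the support from above. From below, the union
of the supports of the values is well defined on classes and equivariant, hence contained in the
least support. -/
lemma mem_supp_sub (x : X) (γ : FreshPow (supp x) Y) (b : 𝔸) :
    b ∈ supp (sub x γ) ↔ ∃ a : supp x, b ∈ supp (γ a) := by
  constructor
  · intro h
    refine (mem_supp_freshPow (show freshPow (supp x) Y from γ) b).1 (supp_subset ?_ h)
    intro π hπ
    exact congrArg (sub x) (supports_supp (show freshPow (supp x) Y from γ) π hπ)
  · intro h
    refine subset_supp_of_equivariant (X := tensor X Y) valueSupp ?_ _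
      ((mem_valueSupp x γ b).2 h)
    intro π
    refine sub_ind fun x γ a ha => ?_
    rw [smul_sub, mem_valueSupp]
    obtain ⟨c, hc⟩ := (mem_valueSupp x γ a).1 ha
    exact ⟨c, smul_mem_supp π hc⟩

lemma supp_apply_subset (x : X) (γ : FreshPow (supp x) Y) (a : supp x) :
    supp (γ a) ⊆ supp (sub x γ) :=
  fun b hb => (mem_supp_sub x γ b).2 ⟨a, hb⟩

end Tensor

/-! ### Gluing permutations and making families fresh -/

section FreshFamilies

lemma FreshPow.eq_of_mem_supp {ι : Type u} {Y : Nom 𝔸} (γ : FreshPow ι Y) {a a' : ι} {b : 𝔸}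
    (h : b ∈ supp (γ a)) (h' : b ∈ supp (γ a')) : a = a' := by
  by_contra hne
  exact Finset.disjoint_left.1 (γ.fresh a a' hne) h h'

/-- Finite permutations relating the values of two fresh families glue to a single one. -/
lemma exists_finPerm_glue {ι : Type u} [Finite ι] {Y : Nom 𝔸} (γ γ' : FreshPow ι Y) (π : ι → FinPerm 𝔸)
    (h : ∀ a, π a • γ a = γ' a) :
    ∃ σ : FinPerm 𝔸, ∀ a, ∀ b ∈ supp (γ a), σ • b = π a • b := by
  classical
  have := Fintype.ofFinite ι
  -- Freshness of `γ` makes the chosen index unique. The value outside these supports plays no role.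
  let f : 𝔸 → 𝔸 := fun b => if hb : ∃ a, b ∈ supp (γ a) then π hb.choose • b else b
  have hf : ∀ a, ∀ b ∈ supp (γ a), f b = π a • b := by
    intro a b hb
    have hex : ∃ a, b ∈ supp (γ a) := ⟨a, hb⟩
    simp only [f, dif_pos hex, γ.eq_of_mem_supp hb hex.choose_spec]
  obtain ⟨σ, hσ⟩ := exists_finPerm_eqOn (Finset.univ.biUnion fun a => supp (γ a)) f (by
    intro b hb b' hb' hbb
    simp only [Finset.coe_biUnion, Set.mem_iUnion, Finset.mem_coe] at hb hb'
    obtain ⟨a, -, ha⟩ := hb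
    obtain ⟨a', -, ha'⟩ := hb'
    rw [hf a b ha, hf a' b' ha'] at hbb
    -- A common image of `b` and `b'` lies in the supports of both `γ' a` and `γ' a'`, so freshness
    -- of `γ'` forces `a = a'`.
    have h1 := h a ▸ smul_mem_supp (π a) ha
    have h2 := h a' ▸ smul_mem_supp (π a') ha'
    rw [hbb] at h1
    obtain rfl := γ'.eq_of_mem_supp h1 h2
    exact smul_left_cancel _ hbb)
  exact ⟨σ, fun a b hb => by
    rw [hσ b (Finset.mem_biUnion.2 ⟨a, Finset.mem_univ a, hb⟩), hf a b hb]⟩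

variable [Infinite 𝔸] {Y : Nom 𝔸}

lemma exists_fresh_smul_nat (E : Finset 𝔸) (y : ℕ → Y) :
    ∃ π : ℕ → FinPerm 𝔸, (∀ n, Disjoint (supp (π n • y n)) E) ∧
      ∀ m n, m ≠ n → Fresh (π m • y m) (π n • y n) := by
  classical
  have hex : ∀ (F : Finset 𝔸) (z : Y), ∃ τ : FinPerm 𝔸, Disjoint (supp (τ • z)) F := by
    intro F z
    obtain ⟨τ, hτ⟩ := exists_smul_disjoint F (supp z)
    refine ⟨τ, Finset.disjoint_left.2 fun a ha haF => hτ _ ((mem_supp_smul τ).1 ha) ?_⟩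
    rwa [smul_inv_smul]
  choose τ hτ using hex
  -- `F n` collects `E` and the supports of all members moved before stage `n`; the next member is
  -- moved off it.
  let F : ℕ → Finset 𝔸 := Nat.rec E fun n G => G ∪ supp (τ G (y n) • y n)
  have hsucc : ∀ n, F (n + 1) = F n ∪ supp (τ (F n) (y n) • y n) := fun n => rfl
  have hmono : Monotone F := monotone_nat_of_le_succ fun n => by
    rw [hsucc]; exact Finset.subset_union_left
  have hlt : ∀ m n, m < n → Fresh (τ (F m) (y m) • y m) (τ (F n) (y n) • y n) := by
    intro m n hmn
    refine (Disjoint.mono_right ?_ (hτ (F n) (y n))).symm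
    refine Finset.Subset.trans ?_ (hmono (Nat.succ_le_of_lt hmn))
    rw [Nat.succ_eq_add_one, hsucc]
    exact Finset.subset_union_right
  refine ⟨fun n => τ (F n) (y n), fun n => (hτ _ _).mono_right (hmono (Nat.zero_le n)), ?_⟩
  intro m n hmn
  rcases lt_or_gt_of_ne hmn with h | h
  · exact hlt m n h
  · exact (hlt n m h).symm

/-- The members of a countable family can be moved so as to become fresh for each other and
for a given finite set of names. -/
lemma exists_fresh_smul {ι : Type*} [Countable ι] (E : Finset 𝔸) (y : ι → Y) :
    ∃ π : ι → FinPerm 𝔸, (∀ a, Disjoint (supp (π a • y a)) E) ∧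
      ∀ a b, a ≠ b → Fresh (π a • y a) (π b • y b) := by
  rcases isEmpty_or_nonempty ι with _ | ⟨⟨i⟩⟩
  · exact ⟨fun _ => 1, isEmptyElim, isEmptyElim⟩
  obtain ⟨e, he⟩ := Countable.exists_injective_nat ι
  obtain ⟨π, h1, h2⟩ := exists_fresh_smul_nat E (Function.extend e y fun _ => y i)
  have h3 : ∀ a, Function.extend e y (fun _ => y i) (e a) = y a := fun a => he.extend_apply _ _ a
  refine ⟨fun a => π (e a), fun a => ?_, fun a b hab => ?_⟩
  · have := h1 (e a)
    rwa [h3] at this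
  · have := h2 _ _ (he.ne hab)
    rwa [h3, h3] at this

end FreshFamilies

/-! ### The associativity isomorphism -/

section Associator

variable [Infinite 𝔸] {X Y Z : Nom 𝔸}

/-- The family `a ↦ γ(a)[δ|_{supp γ(a)}]`. -/
noncomputable def assocPow (x : X) (γ : FreshPow (supp x) Y) (δ : FreshPow (supp (sub x γ)) Z) :
    FreshPow (supp x) (tensor Y Z) where
  toFun a := sub (γ a) (δ.restrict (supp_apply_subset x γ a))
  fresh a a' haa := by
    refine Finset.disjoint_left.2 fun c hc hc' => ?_
    obtain ⟨b, hb⟩ := (mem_supp_sub _ _ _).1 hc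
    obtain ⟨b', hb'⟩ := (mem_supp_sub _ _ _).1 hc'
    have := δ.eq_of_mem_supp hb hb'
    have hbb : b.1 = b'.1 := congrArg (fun z => z.1) this
    exact haa (γ.eq_of_mem_supp b.2 (hbb ▸ b'.2))

/-- One direction makes the associator well defined, the other makes it injective. From left to
right, `ρ` matches the indices and some `π a` matches the values at `a`; the glued `σ` replaces all
the `π a` at once. From right to left the two permutations are simply reused. -/
lemma sub_assocPow_eq_iff {x x' : X} {γ : FreshPow (supp x) Y} {γ' : FreshPow (supp x') Y}
    {δ : FreshPow (supp (sub x γ)) Z} {δ' : FreshPow (supp (sub x' γ')) Z} :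
    sub x (assocPow x γ δ) = sub x' (assocPow x' γ' δ') ↔
      sub (sub x γ) δ = sub (sub x' γ') δ' := by
  constructor
  · intro h
    obtain ⟨ρ, rfl, h4⟩ := exists_of_sub_eq h
    have h5 : ∀ a : supp x, ∃ π : FinPerm 𝔸, π • γ a = γ' (suppMap ρ x a) ∧
        ∀ b (hb : b ∈ supp (γ a)) (hb' : π • b ∈ supp (γ' (suppMap ρ x a))),
          δ ⟨b, supp_apply_subset x γ a hb⟩ =
            δ' ⟨π • b, supp_apply_subset _ γ' _ hb'⟩ :=
      fun a => exists_of_sub_eq (h4 a.1 a.2 (smul_mem_supp ρ a.2))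
    choose π h6 h7 using h5
    obtain ⟨σ, hσ⟩ := exists_finPerm_glue γ (γ'.comp (suppMap ρ x)) π h6
    refine sub_eq_sub σ ?_ fun b hb hb' => ?_
    · rw [smul_sub]
      exact sub_eq_sub ρ rfl fun a ha ha' => (smul_congr (hσ ⟨a, ha⟩)).trans (h6 ⟨a, ha⟩)
    · obtain ⟨a, ha⟩ := (mem_supp_sub x γ b).1 hb
      refine (h7 a b ha (h6 a ▸ smul_mem_supp (π a) ha)).trans (congrArg δ'.toFun ?_)
      exact Subtype.ext (hσ a b ha).symm
  · intro h
    obtain ⟨π, h1, h2⟩ := exists_of_sub_eq h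
    rw [smul_sub] at h1
    obtain ⟨ρ, h3, h4⟩ := exists_of_sub_eq h1
    exact sub_eq_sub ρ h3 fun a ha ha' => sub_eq_sub π (h4 a ha ha') fun b hb hb' => h2 b _ _

lemma sub_sub_ind {P : tensor (tensor X Y) Z → Prop}
    (h : ∀ (x : X) (γ : FreshPow (supp x) Y) (δ : FreshPow (supp (sub x γ)) Z),
      P (sub (sub x γ) δ)) (t : tensor (tensor X Y) Z) : P t :=
  sub_ind (fun t => sub_ind (P := fun t => ∀ δ : FreshPow (supp t) Z, P (sub t δ))
    (fun x γ δ => h x γ δ) t) t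

/-- The index set of `δ` depends on the class `x[γ]`, so the associator is specified by its values
on all representatives instead of by nested lifts. -/
lemma exists_assoc (t : tensor (tensor X Y) Z) :
    ∃ v : tensor X (tensor Y Z), ∀ (x : X) (γ : FreshPow (supp x) Y)
      (δ : FreshPow (supp (sub x γ)) Z), t = sub (sub x γ) δ → v = sub x (assocPow x γ δ) :=
  sub_sub_ind (P := fun t => ∃ v : tensor X (tensor Y Z), ∀ (x : X) (γ : FreshPow (supp x) Y)
      (δ : FreshPow (supp (sub x γ)) Z), t = sub (sub x γ) δ → v = sub x (assocPow x γ δ))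
    (fun _ _ _ => ⟨_, fun _ _ _ h => sub_assocPow_eq_iff.2 h⟩) t

variable (X Y Z) in
/-- The associator `(x[γ])[δ] ↦ x[a ↦ γ(a)[δ|_{supp γ(a)}]]`. -/
noncomputable def assocHom : tensor (tensor X Y) Z ⟶ tensor X (tensor Y Z) :=
  Nom.homMk (fun t => (exists_assoc t).choose) fun π => sub_sub_ind fun x γ δ => by
    rw [(exists_assoc (sub (sub x γ) δ)).choose_spec x γ δ rfl]
    exact (exists_assoc (π • sub (sub x γ) δ)).choose_spec x γ (π • δ) rfl

lemma assocHom_sub (x : X) (γ : FreshPow (supp x) Y) (δ : FreshPow (supp (sub x γ)) Z) :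
    assocHom X Y Z (sub (sub x γ) δ) = sub x (assocPow x γ δ) :=
  (exists_assoc (sub (sub x γ) δ)).choose_spec x γ δ rfl

lemma assocHom_injective : Function.Injective (assocHom X Y Z) := by
  intro t
  refine sub_sub_ind (P := fun t => ∀ t', assocHom X Y Z t = assocHom X Y Z t' → t = t')
    (fun x γ δ => sub_sub_ind fun x' γ' δ' h => ?_) t
  rw [assocHom_sub, assocHom_sub] at h
  exact sub_assocPow_eq_iff.1 h

lemma exists_sub_eq (t : tensor X Y) : ∃ (x : X) (γ : FreshPow (supp x) Y), t = sub x γ :=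
  sub_ind (P := fun t => ∃ (x : X) (γ : FreshPow (supp x) Y), t = sub x γ)
    (fun x γ => ⟨x, γ, rfl⟩) t

lemma exists_smul_sub_eq (x : X) (γ : FreshPow (supp x) Y) (π : FinPerm 𝔸) :
    ∃ γ' : FreshPow (supp (π • x)) Y, sub x γ = sub (π • x) γ' := by
  refine ⟨γ.comp ⟨fun a => ⟨π⁻¹ • a.1, (mem_supp_smul π).1 a.2⟩, fun _ _ h =>
    Subtype.ext (smul_left_cancel π⁻¹ (congrArg (fun z => z.1) h))⟩, ?_⟩
  exact sub_eq_sub π rfl fun a ha ha' =>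
    congrArg γ.toFun (Subtype.ext (inv_smul_smul π a).symm)

/-- The values of `θ` are classes `y[δ]` whose `y` need not be fresh for each other. Moving these
`y` apart changes no class and turns them into a fresh family `γ`; disjointness of supports then
lets the several `δ` be joined into one. -/
lemma assocHom_surjective : Function.Surjective (assocHom X Y Z) := by
  refine sub_ind fun x θ => ?_
  have hrep : ∀ a : supp x, ∃ (y : Y) (δ : FreshPow (supp y) Z), θ a = sub y δ :=
    fun a => exists_sub_eq (θ a)
  choose y₀ δ₀ h₀ using hrep
  obtain ⟨π, -, hπ⟩ := exists_fresh_smul ∅ y₀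
  choose δ₁ h₁ using fun a => exists_smul_sub_eq (y₀ a) (δ₀ a) (π a)
  let γ : FreshPow (supp x) Y := ⟨fun a => π a • y₀ a, hπ⟩
  have hθ : ∀ a, θ a = sub (γ a) (δ₁ a) := fun a => (h₀ a).trans (h₁ a)
  choose i hi using fun b : supp (sub x γ) => (mem_supp_sub x γ b.1).1 b.2
  have hval : ∀ (a : supp x) (b : 𝔸) (hb : b ∈ supp (γ a)) (hb' : b ∈ supp (sub x γ)),
      δ₁ (i ⟨b, hb'⟩) ⟨b, hi ⟨b, hb'⟩⟩ = δ₁ a ⟨b, hb⟩ := by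
    intro a b hb hb'
    have key : ∀ (a' : supp x) (hb'' : b ∈ supp (γ a')), a' = a →
        δ₁ a' ⟨b, hb''⟩ = δ₁ a ⟨b, hb⟩ := by
      rintro a' hb'' rfl
      rfl
    exact key _ _ (γ.eq_of_mem_supp (hi ⟨b, hb'⟩) hb)
  let δ : FreshPow (supp (sub x γ)) Z :=
    ⟨fun b => δ₁ (i b) ⟨b.1, hi b⟩, by
      intro b b' hbb
      -- Names under the same index are separated by freshness of a single `δ₁`, names under
      -- different indices by freshness of `θ`.
      by_cases h : i b = i b'
      · have h2 : b'.1 ∈ supp (γ (i b)) := h ▸ hi b'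
        rw [hval (i b) b'.1 h2 b'.2]
        exact (δ₁ (i b)).fresh _ _ fun h' => hbb (Subtype.ext (congrArg (fun z => z.1) h'))
      · refine (θ.fresh _ _ h).mono ?_ ?_
        · rw [hθ]; exact supp_apply_subset (γ (i b)) (δ₁ (i b)) _
        · rw [hθ]; exact supp_apply_subset (γ (i b')) (δ₁ (i b')) _⟩
  refine ⟨sub (sub x γ) δ, ?_⟩
  rw [assocHom_sub]
  refine congrArg (sub x) (FreshPow.ext (funext fun a => ?_))
  rw [hθ a]
  exact congrArg (sub (γ a)) (FreshPow.ext (funext fun b => hval a b.1 b.2 _))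

variable (X Y Z) in
/-- The associativity isomorphism of the substitution tensor. -/
noncomputable def assocIso : tensor (tensor X Y) Z ≅ tensor X (tensor Y Z) :=
  Nom.isoOfBijective (assocHom X Y Z) ⟨assocHom_injective, assocHom_surjective⟩

end Associator

/-! ### The unit isomorphisms -/

section Unitors

variable [Infinite 𝔸]

/-- The left unitor `a[γ] ↦ γ(a)`. -/
noncomputable def leftUnitorHom (X : Nom 𝔸) : tensor (atoms 𝔸) X ⟶ X :=
  tensorLift (X := atoms 𝔸) (fun a γ => γ ⟨a, mem_supp_atom (𝔸 := 𝔸) a⟩) (fun _ _ _ => rfl)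
    (fun _ _ _ => rfl)

/-- The support of a name is a singleton and all names form one orbit, so `a[γ]` carries no
information besides `γ(a)`. -/
lemma leftUnitorHom_bijective (X : Nom 𝔸) : Function.Bijective (leftUnitorHom X) := by
  constructor
  · intro t t' h
    obtain ⟨a, γ, rfl⟩ := exists_sub_eq t
    obtain ⟨a', γ', rfl⟩ := exists_sub_eq t'
    change 𝔸 at a a'
    refine sub_eq_sub (swp a a') (swp_left a a') fun b hb hb' => ?_
    have hb2 : b = a := by rwa [supp_atom, Finset.mem_singleton] at hb
    subst hb2
    exact h.trans (congrArg γ'.toFun (Subtype.ext (swp_left b a').symm))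
  · intro x
    obtain ⟨a⟩ : Nonempty 𝔸 := inferInstance
    refine ⟨sub (X := atoms 𝔸) a ⟨fun _ => x, fun b b' h => (h (Subtype.ext ?_)).elim⟩, rfl⟩
    have hb : ∀ c : supp (X := atoms 𝔸) a, c.1 = a := fun c =>
      Finset.mem_singleton.1 (Finset.ext_iff.1 (supp_atom a) c.1 |>.1 c.2)
    exact (hb b).trans (hb b').symm

/-- The right unitor `x[γ] ↦ π • x`, where `π` extends `γ`. -/
noncomputable def rightUnitorHom (X : Nom 𝔸) : tensor X (atoms 𝔸) ⟶ X :=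
  tensorLift
    (fun x γ => (exists_finPerm_extend γ.toFun (freshPow_atoms_injective γ)).choose • x)
    (fun π x γ => by
      -- The chosen extensions agree on `supp x` up to composition with `π`, so they act alike on
      -- `x`.
      rw [smul_smul]
      refine smul_congr fun a ha => ?_
      rw [mul_smul]
      exact ((exists_finPerm_extend _ (freshPow_atoms_injective γ)).choose_spec
          (suppMap π x ⟨a, ha⟩)).trans
        ((exists_finPerm_extend _ (freshPow_atoms_injective (γ.comp (suppMap π x)))).choose_spec
          ⟨a, ha⟩).symm)
    (fun π x γ => by
      rw [smul_smul]
      refine smul_congr fun a ha => ?_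
      rw [mul_smul]
      refine ((exists_finPerm_extend _ (freshPow_atoms_injective (π • γ))).choose_spec
        ⟨a, ha⟩).trans (congrArg (fun b : 𝔸 => π • b)
          ((exists_finPerm_extend _ (freshPow_atoms_injective γ)).choose_spec ⟨a, ha⟩).symm))

lemma rightUnitorHom_sub {X : Nom 𝔸} (x : X) (γ : FreshPow (supp x) (atoms 𝔸)) (π : FinPerm 𝔸)
    (h : ∀ a : supp x, γ a = π • a.1) : rightUnitorHom X (sub x γ) = π • x :=
  smul_congr fun a ha =>
    ((exists_finPerm_extend _ (freshPow_atoms_injective γ)).choose_spec ⟨a, ha⟩).trans (h ⟨a, ha⟩)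

lemma exists_finPerm_of_freshPow_atoms {S : Finset 𝔸} (γ : FreshPow S (atoms 𝔸)) :
    ∃ π : FinPerm 𝔸, ∀ a : S, γ a = π • a.1 := by
  obtain ⟨π, hπ⟩ := exists_finPerm_extend γ.toFun (freshPow_atoms_injective γ)
  exact ⟨π, fun a => (hπ a).symm⟩

lemma rightUnitorHom_bijective (X : Nom 𝔸) : Function.Bijective (rightUnitorHom X) := by
  constructor
  · intro t t' h
    obtain ⟨x, γ, rfl⟩ := exists_sub_eq t
    obtain ⟨x', γ', rfl⟩ := exists_sub_eq t'
    obtain ⟨π, hπ⟩ := exists_finPerm_of_freshPow_atoms γ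
    obtain ⟨π', hπ'⟩ := exists_finPerm_of_freshPow_atoms γ'
    rw [rightUnitorHom_sub x γ π hπ, rightUnitorHom_sub x' γ' π' hπ'] at h
    refine sub_eq_sub (π'⁻¹ * π) (by rw [mul_smul, h, inv_smul_smul]) fun a ha ha' => ?_
    refine (hπ ⟨a, ha⟩).trans (Eq.trans ?_ (hπ' ⟨_, ha'⟩).symm)
    change π • a = π' • (π'⁻¹ * π) • a
    rw [mul_smul, smul_inv_smul]
  · intro x
    refine ⟨sub x (show FreshPow (supp x) (atoms 𝔸) from inclAtoms ⟨supp x⟩), ?_⟩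
    exact (rightUnitorHom_sub x _ 1 fun a => (one_smul (FinPerm 𝔸) a.1).symm).trans
      (one_smul _ x)

end Unitors

/-! ### Naturality and coherence -/

section Monoidal

variable [Infinite 𝔸]

/-- The left unit isomorphism of the substitution tensor. -/
noncomputable def leftUnitorIso (X : Nom 𝔸) : tensor (atoms 𝔸) X ≅ X :=
  Nom.isoOfBijective (leftUnitorHom X) (leftUnitorHom_bijective X)

/-- The right unit isomorphism of the substitution tensor. -/
noncomputable def rightUnitorIso (X : Nom 𝔸) : tensor X (atoms 𝔸) ≅ X :=
  Nom.isoOfBijective (rightUnitorHom X) (rightUnitorHom_bijective X)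

lemma assocHom_naturality {X X' Y Y' Z Z' : Nom 𝔸} (f : X ⟶ X') (g : Y ⟶ Y') (h : Z ⟶ Z') :
    tensorMap (tensorMap f g) h ≫ assocHom X' Y' Z' =
      assocHom X Y Z ≫ tensorMap f (tensorMap g h) := by
  refine Nom.hom_ext (sub_sub_ind fun x γ δ => ?_)
  refine (assocHom_sub (f x) _ _).trans ?_
  exact (congrArg (tensorMap f (tensorMap g h)) (assocHom_sub x γ δ)).symm

lemma leftUnitorHom_naturality {X Y : Nom 𝔸} (f : X ⟶ Y) :
    tensorMap (𝟙 (atoms 𝔸)) f ≫ leftUnitorHom Y = leftUnitorHom X ≫ f :=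
  Nom.hom_ext (sub_ind fun _ _ => rfl)

lemma rightUnitorHom_naturality {X Y : Nom 𝔸} (f : X ⟶ Y) :
    tensorMap f (𝟙 (atoms 𝔸)) ≫ rightUnitorHom Y = rightUnitorHom X ≫ f := by
  refine Nom.hom_ext (sub_ind fun x γ => ?_)
  obtain ⟨π, hπ⟩ := exists_finPerm_of_freshPow_atoms γ
  change rightUnitorHom Y (sub (f x) _) = f (rightUnitorHom X (sub x γ))
  rw [rightUnitorHom_sub x γ π hπ, Nom.hom_smul]
  exact rightUnitorHom_sub _ _ π fun a => hπ ⟨a.1, supp_hom_subset f x a.2⟩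

lemma assocHom_pentagon (W X Y Z : Nom 𝔸) :
    tensorMap (assocHom W X Y) (𝟙 Z) ≫ assocHom W (tensor X Y) Z ≫
        tensorMap (𝟙 W) (assocHom X Y Z) =
      assocHom (tensor W X) Y Z ≫ assocHom W X (tensor Y Z) := by
  refine Nom.hom_ext fun t => ?_
  obtain ⟨u, ε, rfl⟩ := exists_sub_eq t
  obtain ⟨v, δ, rfl⟩ := exists_sub_eq u
  obtain ⟨w, γ, rfl⟩ := exists_sub_eq v
  -- Equivariance of the associator gives this inclusion, which allows `ε` to be restricted to the
  -- rebracketed class.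
  have hsub : supp (sub w (assocPow w γ δ)) ⊆ supp (sub (sub w γ) δ) := by
    rw [← assocHom_sub]
    exact supp_hom_subset _ _
  have h1 : tensorMap (assocHom W X Y) (𝟙 Z) (sub (sub (sub w γ) δ) ε) =
      sub (sub w (assocPow w γ δ)) (ε.restrict hsub) :=
    sub_congr (assocHom_sub w γ δ) fun _ _ _ => rfl
  change tensorMap (𝟙 W) (assocHom X Y Z) (assocHom W (tensor X Y) Z
    (tensorMap (assocHom W X Y) (𝟙 Z) (sub (sub (sub w γ) δ) ε))) =
      assocHom W X (tensor Y Z) (assocHom (tensor W X) Y Z (sub (sub (sub w γ) δ) ε))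
  rw [h1, assocHom_sub, assocHom_sub, assocHom_sub]
  refine congrArg (sub w) (FreshPow.ext (funext fun a => ?_))
  exact assocHom_sub (γ a) (δ.restrict (supp_apply_subset w γ a)) _

lemma assocHom_triangle (X Y : Nom 𝔸) :
    assocHom X (atoms 𝔸) Y ≫ tensorMap (𝟙 X) (leftUnitorHom Y) =
      tensorMap (rightUnitorHom X) (𝟙 Y) := by
  refine Nom.hom_ext (sub_sub_ind fun x γ δ => ?_)
  obtain ⟨π, hπ⟩ := exists_finPerm_of_freshPow_atoms γ
  change tensorMap (𝟙 X) (leftUnitorHom Y) (assocHom X (atoms 𝔸) Y (sub (sub x γ) δ)) = _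
  rw [assocHom_sub]
  refine sub_eq_sub π (rightUnitorHom_sub x γ π hπ).symm fun a ha ha' => ?_
  exact congrArg δ.toFun (Subtype.ext (hπ ⟨a, ha⟩))

lemma exists_monoidalCategory : ∃ M : MonoidalCategory (Nom 𝔸),
    M.toMonoidalCategoryStruct = substStruct assocIso leftUnitorIso rightUnitorIso :=
  letI := substStruct (𝔸 := 𝔸) assocIso leftUnitorIso rightUnitorIso
  ⟨{  tensorHom_def := fun _ _ => Nom.hom_ext (sub_ind fun _ _ => rfl)
      id_tensorHom_id := fun _ _ => Nom.hom_ext (sub_ind fun _ _ => rfl)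
      tensorHom_comp_tensorHom := fun _ _ _ _ => Nom.hom_ext (sub_ind fun _ _ => rfl)
      whiskerLeft_id := fun _ _ => Nom.hom_ext (sub_ind fun _ _ => rfl)
      id_whiskerRight := fun _ _ => Nom.hom_ext (sub_ind fun _ _ => rfl)
      associator_naturality := assocHom_naturality
      leftUnitor_naturality := leftUnitorHom_naturality
      rightUnitor_naturality := rightUnitorHom_naturality
      pentagon := assocHom_pentagon
      triangle := assocHom_triangle }, rfl⟩

end Monoidal

/-! ### The universal property of the coend -/

section Coend

variable [Infinite 𝔸] {X Y : Nom 𝔸}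

lemma supp_inclAtoms_subset (A : Ctx 𝔸) : supp (inclAtoms A) ⊆ A.set :=
  supp_subset fun _ hπ => FreshPow.ext (funext fun a => hπ a.2)

lemma supp_apply_inclAtoms_subset {A : Ctx 𝔸} (p : (psi 𝔸).obj (op A) ⟶ X) :
    supp (p (inclAtoms A)) ⊆ A.set :=
  (supp_hom_subset p _).trans (supp_inclAtoms_subset A)

/-- The coprojection `(p, γ) ↦ x[γ|_{supp x}]`, where `x = p(A ↪ 𝔸)`. -/
noncomputable def tensorProj (X Y : Nom 𝔸) (A : Ctx 𝔸) :
    copower ((psi 𝔸).obj (op A) ⟶ X) (freshPow A.set Y) ⟶ tensor X Y :=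
  Nom.homMk (X := copower ((psi 𝔸).obj (op A) ⟶ X) (freshPow A.set Y))
    (fun q => sub (q.1 (inclAtoms A))
      (FreshPow.restrict (show FreshPow A.set Y from q.2) (supp_apply_inclAtoms_subset q.1)))
    (fun _ _ => rfl)

/-- A permutation `π` extending `j` turns the dinaturality of the coprojections into an instance of
the generating relation. -/
lemma tensorProj_comp {A B : Ctx 𝔸} (j : A ⟶ B) (p : (psi 𝔸).obj (op A) ⟶ X)
    (γ : FreshPow B.set Y) :
    tensorProj X Y A (p, γ.comp (show A.set ↪ B.set from j)) =
      tensorProj X Y B ((psi 𝔸).map j.op ≫ p, γ) := by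
  let j' : A.set ↪ B.set := j
  obtain ⟨π, hπ⟩ := exists_finPerm_extend (fun a => (j' a).1)
    (fun a b h => j'.injective (Subtype.ext h))
  refine sub_eq_sub π ?_ fun a ha ha' => congrArg γ.toFun (Subtype.ext ?_)
  · rw [← Nom.hom_smul]
    exact congrArg p (FreshPow.ext (funext hπ))
  · exact (hπ ⟨a, supp_apply_inclAtoms_subset p ha⟩).symm

/-- The substitution tensor as a cowedge. -/
noncomputable def tensorCowedge (X Y : Nom 𝔸) : Cowedge (coendDiagram X Y) :=
  Cowedge.mk (tensor X Y) (tensorProj X Y) fun _ _ j =>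
    Nom.hom_ext fun q => tensorProj_comp j q.1 q.2

lemma cowedgeProj_comp (s : Cowedge (coendDiagram X Y)) {A B : Ctx 𝔸} (j : A ⟶ B)
    (p : (psi 𝔸).obj (op A) ⟶ X) (γ : FreshPow B.set Y) :
    cowedgeProj s A p (γ.comp (show A.set ↪ B.set from j)) =
      cowedgeProj s B ((psi 𝔸).map j.op ≫ p) γ :=
  ConcreteCategory.congr_hom (Cowedge.condition s j)
    (show copower ((psi 𝔸).obj (op A) ⟶ X) (freshPow B.set Y) from (p, γ))

/-- The equivariant map `ψ (supp x) → X` that sends the inclusion to `x`. -/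
noncomputable def orbitMap (x : X) : (psi 𝔸).obj (op ⟨supp x⟩) ⟶ X :=
  Nom.homMk (X := (psi 𝔸).obj (op ⟨supp x⟩))
    (fun δ : FreshPow (supp x) (atoms 𝔸) => rightUnitorHom X (sub x δ))
    (fun π (δ : FreshPow (supp x) (atoms 𝔸)) => Nom.hom_smul (rightUnitorHom X) π (sub x δ))

lemma orbitMap_inclAtoms (x : X) : orbitMap x (inclAtoms ⟨supp x⟩) = x :=
  (rightUnitorHom_sub x _ 1 fun a => (one_smul (FinPerm 𝔸) a.1).symm).trans (one_smul _ x)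

lemma map_comp_orbitMap_smul (π : FinPerm 𝔸) (x : X) :
    (psi 𝔸).map (Quiver.Hom.op (show (⟨supp x⟩ : Ctx 𝔸) ⟶ ⟨supp (π • x)⟩ from suppMap π x)) ≫
      orbitMap x = orbitMap (π • x) :=
  Nom.hom_ext fun δ => (congrArg (rightUnitorHom X)
    (sub_smul π x (show FreshPow (supp (π • x)) (atoms 𝔸) from δ))).symm

/-- The inclusion of finite sets of names as a morphism of `𝕀`. -/
def Ctx.incl {A B : Finset 𝔸} (h : A ⊆ B) : (⟨A⟩ : Ctx 𝔸) ⟶ ⟨B⟩ :=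
  (⟨fun a => ⟨a.1, h a.2⟩, fun _ _ h' =>
    Subtype.ext (congrArg (fun z => z.1) h')⟩ : A ↪ B)

/-- Every `δ` in `ψ A` is `π • inclAtoms A` for some `π`, so equivariance determines `p` from its
value at the inclusion. -/
lemma map_comp_orbitMap {A : Ctx 𝔸} (p : (psi 𝔸).obj (op A) ⟶ X) :
    (psi 𝔸).map (Ctx.incl (supp_apply_inclAtoms_subset p)).op ≫ orbitMap (p (inclAtoms A)) =
      p := by
  refine Nom.hom_ext fun δ => ?_
  obtain ⟨π, hπ⟩ := exists_finPerm_of_freshPow_atoms (show FreshPow A.set (atoms 𝔸) from δ)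
  have hδ : δ = π • inclAtoms A := FreshPow.ext (funext hπ)
  refine (rightUnitorHom_sub (p (inclAtoms A)) _ π fun a => hπ _).trans ?_
  rw [← Nom.hom_smul, hδ]

/-- The map from the substitution tensor to the point of a cowedge. -/
noncomputable def tensorDesc (s : Cowedge (coendDiagram X Y)) : tensor X Y ⟶ s.pt :=
  tensorLift (fun x γ => cowedgeProj s ⟨supp x⟩ (orbitMap x) γ)
    (fun π x γ => by
      rw [← map_comp_orbitMap_smul π x]
      exact (cowedgeProj_comp s _ (orbitMap x) γ).symm)
    (fun π x γ => Nom.hom_smul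
      (show copower ((psi 𝔸).obj (op ⟨supp x⟩) ⟶ X) (freshPow (supp x) Y) ⟶ s.pt from
        s.π ⟨supp x⟩) π (orbitMap x, γ))

lemma tensorDesc_tensorProj (s : Cowedge (coendDiagram X Y)) (A : Ctx 𝔸)
    (p : (psi 𝔸).obj (op A) ⟶ X) (γ : FreshPow A.set Y) :
    tensorDesc s (tensorProj X Y A (p, γ)) = cowedgeProj s A p γ := by
  have h := cowedgeProj_comp s (Ctx.incl (supp_apply_inclAtoms_subset p))
    (orbitMap (p (inclAtoms A))) γ
  rw [map_comp_orbitMap] at h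
  exact h

/-- The coprojections are thus jointly surjective, which gives uniqueness in the universal property.
-/
lemma tensorProj_orbitMap (x : X) (γ : FreshPow (supp x) Y) :
    tensorProj X Y ⟨supp x⟩ (orbitMap x, γ) = sub x γ :=
  sub_congr (orbitMap_inclAtoms x) fun _ _ _ => rfl

/-- The substitution tensor is the coend of `Nom(ψ A, X) · Y^{*A}`. -/
noncomputable def tensorCowedgeIsColimit (X Y : Nom 𝔸) : IsColimit (tensorCowedge X Y) :=
  Multicofork.IsColimit.mk _ (fun s => tensorDesc s)
    (fun s A => Nom.hom_ext fun q => tensorDesc_tensorProj s A q.1 q.2)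
    (fun s m hm => Nom.hom_ext (sub_ind fun x γ => by
      refine (congrArg m (tensorProj_orbitMap x γ).symm).trans ?_
      exact ConcreteCategory.congr_hom (hm ⟨supp x⟩)
        (show copower ((psi 𝔸).obj (op ⟨supp x⟩) ⟶ X) (freshPow (supp x) Y) from
          (orbitMap x, γ))))

/-- For a one-element set `A`, evaluation is an isomorphism `ψ A ≅ 𝔸`. -/
lemma nonempty_psi_iso_atoms (A : Ctx 𝔸) (hA : A.set.card = 1) :
    Nonempty ((psi 𝔸).obj (op A) ≅ atoms 𝔸) := by
  obtain ⟨a, ha⟩ := Finset.card_eq_one.1 hA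
  have haA : a ∈ A.set := ha ▸ Finset.mem_singleton_self a
  have hsub : ∀ b : A.set, b = ⟨a, haA⟩ := fun b =>
    Subtype.ext (Finset.mem_singleton.1 (Finset.ext_iff.1 ha b.1 |>.1 b.2))
  refine ⟨Nom.isoOfBijective (X := (psi 𝔸).obj (op A)) (Y := atoms 𝔸)
    (Nom.homMk (X := freshPow A.set (atoms 𝔸)) (Y := atoms 𝔸)
      (fun γ : FreshPow A.set (atoms 𝔸) => γ ⟨a, haA⟩) fun _ _ => rfl) ⟨?_, ?_⟩⟩
  · intro γ γ' h
    refine FreshPow.ext (funext fun b => ?_)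
    rw [hsub b]
    exact h
  · intro c
    exact ⟨(⟨fun _ => c, fun b b' h => (h ((hsub b).trans (hsub b').symm)).elim⟩ :
      FreshPow A.set (atoms 𝔸)), rfl⟩

end Coend

/-! ### The internal hom and the adjunction -/

section Hom

open Classical in
/-- The family that agrees with `γ` on `A` and with `δ` outside `A`. -/
noncomputable def FreshPow.splice {A : Finset 𝔸} {Y : Nom 𝔸} (γ : FreshPow A Y) (δ : 𝔸 → Y)
    (hδ : ∀ b c, b ≠ c → b ∉ A → c ∉ A → Fresh (δ b) (δ c))
    (h : ∀ (a : A) (b : 𝔸), b ∉ A → Fresh (γ a) (δ b)) : FreshPow 𝔸 Y where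
  toFun a := if ha : a ∈ A then γ ⟨a, ha⟩ else δ a
  fresh a b hab := by
    by_cases ha : a ∈ A <;> by_cases hb : b ∈ A <;> simp only [ha, hb, dif_pos, dif_neg,
      not_false_eq_true]
    · exact γ.fresh _ _ fun h' => hab (congrArg (fun z => z.1) h')
    · exact h _ _ hb
    · exact (h _ _ ha).symm
    · exact hδ a b hab ha hb

section

variable {A : Finset 𝔸} {Y : Nom 𝔸} (γ : FreshPow A Y) (δ : 𝔸 → Y)
  (hδ : ∀ b c, b ≠ c → b ∉ A → c ∉ A → Fresh (δ b) (δ c))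
  (h : ∀ (a : A) (b : 𝔸), b ∉ A → Fresh (γ a) (δ b))

lemma FreshPow.splice_of_mem {a : 𝔸} (ha : a ∈ A) : γ.splice δ hδ h a = γ ⟨a, ha⟩ :=
  dif_pos ha

lemma FreshPow.splice_of_notMem {a : 𝔸} (ha : a ∉ A) : γ.splice δ hδ h a = δ a :=
  dif_neg ha

lemma FreshPow.splice_proj : (γ.splice δ hδ h).proj A = γ :=
  FreshPow.ext (funext fun a => γ.splice_of_mem δ hδ h a.2)

end

lemma homEval_smul {Y Z : Nom 𝔸} (π : FinPerm 𝔸) (f : homObj Y Z) (γ : FreshPow 𝔸 Y) :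
    homEval f (π • γ) = π • homEval f γ := (FinRedMap.hom f).map_smul π γ

variable [Infinite 𝔸]

/-- A finite fresh family in a nonempty nominal set extends to all names, with the new values
fresh for a given finite set. -/
lemma exists_freshPow_extension [Countable 𝔸] {Y : Nom 𝔸} [hY : Nonempty Y] {A : Finset 𝔸}
    (E : Finset 𝔸) (γ : FreshPow A Y) :
    ∃ γ' : FreshPow 𝔸 Y, γ'.proj A = γ ∧ ∀ a ∉ A, Disjoint (supp (γ' a)) E := by
  classical
  obtain ⟨y⟩ := hY
  obtain ⟨π, h1, h2⟩ := exists_fresh_smul (ι := 𝔸)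
    -- Permuted copies of a single element of `Y` supply all the missing values.
    (E ∪ Finset.univ.biUnion fun a => supp (γ a)) (fun _ => y)
  refine ⟨γ.splice (fun a => π a • y) (fun b c hbc _ _ => h2 b c hbc) fun a b _ => ?_,
    γ.splice_proj _ _ _, fun a ha => ?_⟩
  · refine ((h1 b).mono_right ?_).symm
    exact (Finset.subset_biUnion_of_mem (fun a => supp (γ a)) (Finset.mem_univ a)).trans
      Finset.subset_union_right
  · exact (congrArg (fun z : Y => Disjoint (supp z) E)
      (FreshPow.splice_of_notMem _ _ _ _ ha)).mpr ((h1 a).mono_right Finset.subset_union_left)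

lemma finset_ssubset_univ (A : Finset 𝔸) : (A : Set 𝔸) ⊂ Set.univ :=
  Set.ssubset_univ_iff.2 fun h => Set.infinite_univ (h ▸ A.finite_toSet)

variable {X Y Z : Nom 𝔸}

/-- Splice `γ` on `A` with `δ` off `A` to get `ε`, which has the same value as `γ`. A permutation
`τ` fixing `supp f` and pushing the rest of `A` out of `A` fixes `f`, and after reindexing by `τ`
the families `ε` and `δ` agree on `A`. -/
lemma homEval_eq_of_fresh {f : homObj Y Z} {A : Finset 𝔸}
    (hA : ∀ γ γ' : FreshPow 𝔸 Y, (∀ a ∈ A, γ a = γ' a) → homEval f γ = homEval f γ')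
    {γ δ : FreshPow 𝔸 Y} (hγ : ∀ a ∈ supp f, γ a = δ a)
    (h : ∀ a ∈ A, ∀ b ∉ A, Fresh (γ a) (δ b)) : homEval f γ = homEval f δ := by
  classical
  obtain ⟨τ, h1, h2⟩ := exists_move (supp f) A (A \ supp f) Finset.sdiff_disjoint
  have hτ : τ • f = f := supports_supp f τ fun a ha => h1 a ha
  have hpre : ∀ ε : FreshPow 𝔸 Y, homEval f (ε.precomp τ) = homEval f ε := fun ε =>
    congrArg (fun g : homObj Y Z => homEval g ε) hτ
  let ε := (γ.proj A).splice δ (fun b c hbc _ _ => δ.fresh b c hbc) fun a b hb => h a.1 a.2 b hb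
  have hε : ∀ a ∈ A, ε a = γ a := fun a ha => FreshPow.splice_of_mem _ _ _ _ ha
  rw [← hA ε γ hε, ← hpre ε, ← hpre δ]
  refine hA _ _ fun a ha => ?_
  change ε (τ • a) = δ (τ • a)
  by_cases hs : a ∈ supp f
  · rw [h1 a hs, hε a ha, hγ a hs]
  · exact FreshPow.splice_of_notMem _ _ _ _ (h2 a (Finset.mem_sdiff.2 ⟨ha, hs⟩))

/-- The value of `f ∈ Y ⊸ Z` at `γ` depends only on the restriction of `γ` to `supp f`. -/
lemma homEval_congr [Countable 𝔸] [Nonempty Y] (f : homObj Y Z) {γ γ' : FreshPow 𝔸 Y}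
    (h : ∀ a ∈ supp f, γ a = γ' a) : homEval f γ = homEval f γ' := by
  classical
  obtain ⟨A₀, -, g, hg⟩ := FinRedMap.reducible f
  let A := A₀ ∪ supp f
  have hA : ∀ γ γ' : FreshPow 𝔸 Y, (∀ a ∈ A, γ a = γ' a) → homEval f γ = homEval f γ' := by
    intro γ γ' hγ
    refine (hg γ).trans (Eq.trans (congrArg g ?_) (hg γ').symm)
    exact FreshPow.ext (funext fun a => hγ a.1 (Finset.mem_union_left _ a.2))
  have hS : supp f ⊆ A := Finset.subset_union_right
  -- The families `γ` and `γ'` need not be fresh for each other, so they cannot be spliced directly.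
  -- Both are compared with a third family `δ` that agrees with them on `supp f` and is fresh for
  -- their values on `A` elsewhere.
  obtain ⟨δ, hδ, hE⟩ := exists_freshPow_extension
    ((A.biUnion fun a => supp (γ a)) ∪ A.biUnion fun a => supp (γ' a)) (γ.proj (supp f))
  have hδγ : ∀ a ∈ supp f, γ a = δ a := fun a ha =>
    (congrArg (fun ε : FreshPow (supp f) Y => ε ⟨a, ha⟩) hδ).symm
  refine (homEval_eq_of_fresh hA hδγ fun a ha b hb => ?_).trans
    (homEval_eq_of_fresh hA (fun a ha => (h a ha).symm.trans (hδγ a ha))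
      fun a ha b hb => ?_).symm
  · exact ((hE b fun hb' => hb (hS hb')).mono_right
      ((Finset.subset_biUnion_of_mem (fun a => supp (γ a)) ha).trans
        Finset.subset_union_left)).symm
  · exact ((hE b fun hb' => hb (hS hb')).mono_right
      ((Finset.subset_biUnion_of_mem (fun a => supp (γ' a)) ha).trans
        Finset.subset_union_right)).symm

/-- The transpose `x ↦ (γ ↦ f(x[γ|_{supp x}]))`. -/
noncomputable def tensorCurry (f : tensor X Y ⟶ Z) : X ⟶ homObj Y Z :=
  Nom.homMk (Y := homObj Y Z)
    (fun x =>
      { hom :=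
          { toFun := fun γ => f (sub x (γ.proj (supp x)))
            map_smul' := fun π γ => Nom.hom_smul f π (sub x (γ.proj (supp x))) }
        reducible := ⟨supp x, finset_ssubset_univ _, fun γ => f (sub x γ), fun _ => rfl⟩ })
    (fun π x => FinRedMap.ext fun γ => congrArg f (sub_smul π x (γ.proj (supp (π • x)))))

variable [Countable 𝔸] [Nonempty Y]

lemma homEval_apply_congr (g : X ⟶ homObj Y Z) {x : X} {γ γ' : FreshPow 𝔸 Y}
    (h : γ.proj (supp x) = γ'.proj (supp x)) : homEval (g x) γ = homEval (g x) γ' :=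
  homEval_congr _ fun a ha =>
    congrArg (fun ε : FreshPow (supp x) Y => ε ⟨a, supp_hom_subset g x ha⟩) h

lemma exists_proj_eq {A : Finset 𝔸} (γ : FreshPow A Y) : ∃ γ' : FreshPow 𝔸 Y, γ'.proj A = γ :=
  (exists_freshPow_extension ∅ γ).imp fun _ h => h.1

/-- The inverse transpose `x[γ] ↦ g(x)(γ')` for any extension `γ'` of `γ`. -/
noncomputable def tensorUncurry (g : X ⟶ homObj Y Z) : tensor X Y ⟶ Z :=
  tensorLift (fun x γ => homEval (g x) (exists_proj_eq γ).choose)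
    (fun π x γ => by
      have h : homEval (g (π • x)) (exists_proj_eq γ).choose =
          homEval (g x) ((exists_proj_eq γ).choose.precomp π) := by
        rw [Nom.hom_smul]
        rfl
      refine h.trans (homEval_apply_congr g (Eq.trans ?_
        (exists_proj_eq (γ.comp (suppMap π x))).choose_spec.symm))
      exact congrArg (fun ε : FreshPow (supp (π • x)) Y => ε.comp (suppMap π x))
        (exists_proj_eq γ).choose_spec)
    (fun π x γ => by
      rw [← homEval_smul]
      refine homEval_apply_congr g ((exists_proj_eq (π • γ)).choose_spec.trans ?_)
      exact congrArg (fun ε : FreshPow (supp x) Y => π • ε) (exists_proj_eq γ).choose_spec.symm)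

lemma tensorUncurry_sub (g : X ⟶ homObj Y Z) (x : X) (γ : FreshPow (supp x) Y)
    (γ' : FreshPow 𝔸 Y) (h : γ'.proj (supp x) = γ) :
    tensorUncurry g (sub x γ) = homEval (g x) γ' :=
  homEval_apply_congr g ((exists_proj_eq γ).choose_spec.trans h.symm)

variable (X Y Z) in
/-- Transposition as a bijection. -/
noncomputable def tensorHomEquiv : (tensor X Y ⟶ Z) ≃ (X ⟶ homObj Y Z) where
  toFun := tensorCurry
  invFun := tensorUncurry
  left_inv f := Nom.hom_ext (sub_ind fun x γ => by
    -- Every fresh family on `supp x` is a restriction, so it suffices to check restricted families.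
    obtain ⟨γ', rfl⟩ := exists_proj_eq γ
    exact tensorUncurry_sub _ x _ γ' rfl)
  right_inv g := Nom.hom_ext fun x => FinRedMap.ext fun γ => tensorUncurry_sub g x _ γ rfl

variable (Y) in
/-- The functor `(-) ⋄ Y` is left adjoint to `Y ⊸ (-)`. -/
noncomputable def tensorHomAdjunction : tensorRightFunctor Y ⊣ homFunctor Y :=
  Adjunction.mkOfHomEquiv
    { homEquiv := fun X Z => tensorHomEquiv X Y Z
      homEquiv_naturality_left_symm := fun {X' X Z} f g => Nom.hom_ext (sub_ind fun x γ => by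
        obtain ⟨γ', rfl⟩ := exists_proj_eq γ
        exact (tensorUncurry_sub (f ≫ g) x _ γ' rfl).trans
          (tensorUncurry_sub g (f x) _ γ' rfl).symm)
      homEquiv_naturality_right := fun _ _ => rfl }

lemma tensorHomAdjunction_homEquiv :
    (tensorHomAdjunction Y).homEquiv X Z = tensorHomEquiv X Y Z :=
  congrFun (congrFun (Adjunction.mkOfHomEquiv_homEquiv _) X) Z

end Hom

end NomSubst

theorem mainTheorem4 (𝔸 : Type u) [Countable 𝔸] [Infinite 𝔸] :
    -- the quotient of pairs is the coend defining the substitution tensor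
    (∃ (c : ∀ X Y : Nom 𝔸, Cowedge (coendDiagram X Y))
        (e : ∀ X Y : Nom 𝔸, (c X Y).pt ≅ tensor X Y),
      (∀ X Y : Nom 𝔸, Nonempty (IsColimit (c X Y))) ∧
      (∀ (X Y : Nom 𝔸) (A : Ctx 𝔸) (p : (psi 𝔸).obj (op A) ⟶ X) (γ : FreshPow A.set Y),
        ∃ h : supp (p (inclAtoms A)) ⊆ A.set,
          (e X Y).hom (cowedgeProj (c X Y) A p γ) = sub (p (inclAtoms A)) (γ.restrict h)) ∧
      (∀ (X X' Y Y' : Nom 𝔸) (f : X ⟶ X') (g : Y ⟶ Y') (A : Ctx 𝔸)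
          (p : (psi 𝔸).obj (op A) ⟶ X) (γ : FreshPow A.set Y),
        tensorMap f g ((e X Y).hom (cowedgeProj (c X Y) A p γ)) =
          (e X' Y').hom (cowedgeProj (c X' Y') A (p ≫ f) (γ.map g)))) ∧
    -- action and least supports in the tensor
    (∀ (X Y : Nom 𝔸) (x : X) (γ : FreshPow (supp x) Y),
      (∀ π : FinPerm 𝔸, π • sub x γ = sub x (π • γ)) ∧
      supp (sub x γ) = supp (X := freshPow (supp x) Y) γ ∧
      ∀ b : 𝔸, b ∈ supp (sub x γ) ↔ ∃ a : supp x, b ∈ supp (γ a)) ∧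
    -- the unit is `ψ 1`
    (∀ A : Ctx 𝔸, A.set.card = 1 → Nonempty ((psi 𝔸).obj (op A) ≅ atoms 𝔸)) ∧
    -- the monoidal structure, with its associators and unitors
    (∃ (α : ∀ X Y Z : Nom 𝔸, tensor (tensor X Y) Z ≅ tensor X (tensor Y Z))
        (l : ∀ X : Nom 𝔸, tensor (atoms 𝔸) X ≅ X)
        (r : ∀ X : Nom 𝔸, tensor X (atoms 𝔸) ≅ X),
      (∀ (X Y Z : Nom 𝔸) (x : X) (γ : FreshPow (supp x) Y)
          (δ : FreshPow (supp (sub x γ)) Z),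
        ∃ θ : FreshPow (supp x) (tensor Y Z),
          (∀ a : supp x, ∃ h : supp (γ a) ⊆ supp (sub x γ),
            θ a = sub (γ a) (δ.restrict h)) ∧
          (α X Y Z).hom (sub (sub x γ) δ) = sub x θ) ∧
      (∀ (X : Nom 𝔸) (a : atoms 𝔸) (γ : FreshPow (supp a) X),
        ∃ h : a ∈ supp a, (l X).hom (sub a γ) = γ ⟨a, h⟩) ∧
      (∀ (X : Nom 𝔸) (x : X) (γ : FreshPow (supp x) (atoms 𝔸)) (π : FinPerm 𝔸),
        (∀ a : supp x, γ a = π • a.1) → (r X).hom (sub x γ) = π • x) ∧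
      ∃ M : MonoidalCategory (Nom 𝔸), M.toMonoidalCategoryStruct = substStruct α l r) ∧
    -- right closedness
    (∀ Y : Nom 𝔸, Nonempty Y →
      ∃ adj : tensorRightFunctor Y ⊣ homFunctor Y,
        (∀ (X Z : Nom 𝔸) (f : tensor X Y ⟶ Z) (x : X) (γ : FreshPow 𝔸 Y),
          homEval (adj.homEquiv X Z f x) γ = f (sub x (γ.proj (supp x)))) ∧
        (∀ (X Z : Nom 𝔸) (g : X ⟶ homObj Y Z) (x : X) (γ : FreshPow (supp x) Y),
          (∃ γ' : FreshPow 𝔸 Y, γ'.proj (supp x) = γ) ∧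
          ∀ γ' : FreshPow 𝔸 Y, γ'.proj (supp x) = γ →
            ((adj.homEquiv X Z).symm g : tensor X Y ⟶ Z) (sub x γ) =
              homEval (g x) γ')) := by
  refine ⟨⟨tensorCowedge, fun X Y => Iso.refl _, fun X Y => ⟨tensorCowedgeIsColimit X Y⟩,
      fun X Y A p γ => ⟨supp_apply_inclAtoms_subset p, rfl⟩, fun _ _ _ _ _ _ _ _ _ => rfl⟩,
    fun X Y x γ => ⟨fun π => rfl, ?_, mem_supp_sub x γ⟩, nonempty_psi_iso_atoms,
    ⟨assocIso, leftUnitorIso, rightUnitorIso, ?_, ?_, fun X => rightUnitorHom_sub,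
      exists_monoidalCategory⟩, ?_⟩
  · ext b
    exact (mem_supp_sub x γ b).trans (mem_supp_freshPow (show freshPow (supp x) Y from γ) b).symm
  · exact fun X Y Z x γ δ => ⟨assocPow x γ δ, fun a => ⟨supp_apply_subset x γ a, rfl⟩,
      assocHom_sub x γ δ⟩
  · exact fun X a γ => ⟨mem_supp_atom (𝔸 := 𝔸) a, rfl⟩
  · intro Y hY
    refine ⟨tensorHomAdjunction Y, fun X Z f x γ => ?_, fun X Z g x γ =>
      ⟨exists_proj_eq γ, fun γ' h => ?_⟩⟩
    · rw [tensorHomAdjunction_homEquiv]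
      rfl
    · rw [tensorHomAdjunction_homEquiv]
      exact tensorUncurry_sub g x γ γ' h
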